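/- Let $g(t)=2^{1/4}e^{-\pi t^2}$. For $z=\tau+i\omega\in\mathbb C$ put $\varphi_z(t)=g(t-\tau)e^{-2i\pi\omega t}$, and for a tempered distribution $y$ on $\mathbb R$ (in particular, for a bounded measurable function, where the pairing is an integral) let $\mathrm{Spec}_g(y)(z)=|\langle y,\varphi_z\rangle|^2$; thus $\mathrm{Spec}_g(y)(z)=\left|\int_{\mathbb R}y(t)g(t-\tau)e^{-2i\pi\omega t}\,dt\right|^2$ when $y$ is a bounded measurable function. Let $\xi$ be a complex white Gaussian noise on $\mathbb R$, that is, a random tempered distribution with $\mathbb E\left[e^{i\,\mathrm{Re}\langle\xi,\varphi\rangle}\right]=e^{-\|\varphi\|_{L^2}^2/4}$ for every complex Schwartz function $\varphi$ (equivalently, the variables $\langle\xi,\varphi\rangle$ are jointly circular complex Gaussian with $\mathbb E|\langle\xi,\varphi\rangle|^2=\|\varphi\|_{L^2}^2$). Let $\gamma_1,\gamma_2>0$, $a_1,a_2,b\in\mathbb R$, and $$x(t)=\sqrt{\gamma_1}\,e^{2i\pi t(a_1+bt)}+\sqrt{\gamma_2}\,e^{2i\pi t(a_2+bt)}.$$ Put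 $\sigma_b=\sqrt{\frac{2}{1+4b^2}}$, $a=\frac{\sigma_b}{\sqrt2}(a_2-a_1)$ and, for $z=\tau+i\omega$, $$r=\frac{\sigma_b}{\sqrt2}(\omega-2b\tau-a_1),\qquad s=\frac{\sigma_b}{\sqrt2}\bigl(\tau+2b\omega-(a_1+a_2)b\bigr).$$ Then $\mathrm{Spec}_g(x)(z)$ is the following function of $(r,s)$: $$\mathrm{Spec}_g(x)(r,s)=\sigma_b\left(\gamma_1e^{-2\pi r^2}+\gamma_2e^{-2\pi(r-a)^2}+2\sqrt{\gamma_1\gamma_2}\,e^{-\pi r^2-\pi(r-a)^2}\cos(2\pi as)\right).$$ For bounded Borel $A\subset\mathbb C$ let $N(A)$ be the number of zeros of $\mathrm{Spec}_g(x+\xi)$ in $A$. Then $N(A)$ is (almost surely equal to) a random variable and the zeros have an intensity function $\rho\ge 0$ with respect to Lebesgue measure on $\mathbb C$, i.e. $\mathbb E[N(A)]=\int_A\rho(z)\,dz$ for every bounded Borel set $A\subset\mathbb C$. It is unique up to Lebesgue-null sets, depends on $z$ only through $(r,s)$, and is given by $$\rho(r,s)=e^{-\mathrm{Spec}_g(x)(r,s)}\Bigl(1+4\pi\sigma_b\bigl(\gamma_1r^2e^{-2\pi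 r^2}+\gamma_2(r-a)^2e^{-2\pi(r-a)^2}+2\sqrt{\gamma_1\gamma_2}\,r(r-a)e^{-\pi r^2-\pi(r-a)^2}\cos(2\pi as)\bigr)\Bigr).$$ -/

import Mathlib

open MeasureTheory
open scoped SchwartzMap

noncomputable section

namespace NoisyChirps

/-- The Gaussian window `g(t) = 2^{1/4} e^{-π t²}`. -/
def gaussWindow (t : ℝ) : ℝ := (2 : ℝ) ^ (1 / 4 : ℝ) * Real.exp (-Real.pi * t ^ 2)

/-- The function `t ↦ g(t - τ) e^{-2 i π ω t}` attached to `z = τ + i ω`. -/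
def atomFun (z : ℂ) (t : ℝ) : ℂ :=
  (gaussWindow (t - z.re) : ℂ) * Complex.exp (-2 * Complex.I * Real.pi * z.im * t)

/-- The short-time Fourier transform with Gaussian window,
`∫ x(t) g(t - τ) e^{-2 i π ω t} dt` at `z = τ + i ω`. -/
def stft (x : ℝ → ℂ) (z : ℂ) : ℂ := ∫ t : ℝ, x t * atomFun z t

/-- The spectrogram `Spec_g(x)(z)` of a function `x`. -/
def spectrogram (x : ℝ → ℂ) (z : ℂ) : ℝ := ‖stft x z‖ ^ 2

/-! ### The time-frequency atoms are Schwartz functions -/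

theorem atomFun_eq (z : ℂ) : ∃ K : ℂ, ∀ t : ℝ, atomFun z t =
    K * Complex.exp (-Real.pi * (t : ℂ) ^ 2 +
      (2 * Real.pi * z.re - 2 * Complex.I * Real.pi * z.im) * t) := by
  refine ⟨(((2 : ℝ) ^ (1 / 4 : ℝ) : ℝ) : ℂ) * Complex.exp (-Real.pi * (z.re : ℂ) ^ 2), fun t => ?_⟩
  unfold atomFun gaussWindow
  rw [Complex.ofReal_mul, mul_assoc (((2 : ℝ) ^ (1 / 4 : ℝ) : ℝ) : ℂ),
    mul_assoc (((2 : ℝ) ^ (1 / 4 : ℝ) : ℝ) : ℂ), Complex.ofReal_exp, ← Complex.exp_add,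
    ← Complex.exp_add]
  congr 2
  push_cast
  ring

theorem iteratedDeriv_gauss (c : ℂ) (n : ℕ) : ∃ p : Polynomial ℂ,
    iteratedDeriv n (fun t : ℝ => Complex.exp (-Real.pi * (t : ℂ) ^ 2 + c * t)) =
      fun t : ℝ => p.eval (t : ℂ) * Complex.exp (-Real.pi * (t : ℂ) ^ 2 + c * t) := by
  induction n with
  | zero => exact ⟨1, by simp⟩
  | succ n ih =>
    obtain ⟨p, hp⟩ := ih
    refine ⟨p.derivative + p * (Polynomial.C (-2 * Real.pi : ℂ) * Polynomial.X + Polynomial.C c), ?_⟩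
    rw [iteratedDeriv_succ, hp]
    funext t
    have h1 : HasDerivAt (fun w : ℂ => p.eval w * Complex.exp (-Real.pi * w ^ 2 + c * w))
        (p.derivative.eval (t : ℂ) * Complex.exp (-Real.pi * (t : ℂ) ^ 2 + c * t) +
          p.eval (t : ℂ) * (Complex.exp (-Real.pi * (t : ℂ) ^ 2 + c * t) *
            (-Real.pi * (2 * (t : ℂ)) + c))) (t : ℂ) := by
      refine (p.hasDerivAt (t : ℂ)).mul (HasDerivAt.cexp ?_)
      have ha := ((hasDerivAt_id (t : ℂ)).pow 2).const_mul (-Real.pi : ℂ)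
      have hb := (hasDerivAt_id (t : ℂ)).const_mul c
      refine (ha.add hb).congr_deriv ?_
      simp
    have h2 := h1.comp_ofReal
    rw [h2.deriv]
    simp only [Polynomial.eval_add, Polynomial.eval_mul, Polynomial.eval_C, Polynomial.eval_X]
    ring

theorem pow_mul_gauss_bounded (c : ℂ) (k : ℕ) : ∃ C : ℝ, ∀ t : ℝ,
    |t| ^ k * ‖Complex.exp (-Real.pi * (t : ℂ) ^ 2 + c * t)‖ ≤ C := by
  refine ⟨(1 + k.factorial) * Real.exp (c.re ^ 2), fun t => ?_⟩
  have hre : (-Real.pi * (t : ℂ) ^ 2 + c * t).re = -Real.pi * t ^ 2 + c.re * t := by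
    simp [pow_two]
  rw [Complex.norm_exp, hre]
  have hpi := Real.pi_gt_three
  have h1 : Real.exp (-Real.pi * t ^ 2 + c.re * t) ≤ Real.exp (c.re ^ 2) * Real.exp (-(t ^ 2)) := by
    rw [← Real.exp_add, Real.exp_le_exp]
    nlinarith [sq_nonneg (t - c.re), sq_nonneg t, sq_nonneg c.re]
  have h2 : |t| ^ k * Real.exp (-(t ^ 2)) ≤ 1 + k.factorial := by
    have h3 : |t| ^ k ≤ 1 + (t ^ 2) ^ k := by
      have h4 : (t ^ 2) ^ k = (|t| ^ k) ^ 2 := by rw [← sq_abs, ← pow_mul, ← pow_mul, mul_comm]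
      rw [h4]
      nlinarith [sq_nonneg (|t| ^ k - 1), sq_nonneg (|t| ^ k)]
    have h5 := Real.pow_div_factorial_le_exp (t ^ 2) (sq_nonneg t) k
    have hf : (0 : ℝ) < k.factorial := by positivity
    rw [div_le_iff₀ hf] at h5
    have h6 : (1 : ℝ) ≤ Real.exp (t ^ 2) := Real.one_le_exp (sq_nonneg t)
    rw [Real.exp_neg, ← div_eq_mul_inv, div_le_iff₀ (Real.exp_pos _)]
    nlinarith
  calc |t| ^ k * Real.exp (-Real.pi * t ^ 2 + c.re * t)
      ≤ |t| ^ k * (Real.exp (c.re ^ 2) * Real.exp (-(t ^ 2))) := by gcongr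
    _ = (|t| ^ k * Real.exp (-(t ^ 2))) * Real.exp (c.re ^ 2) := by ring
    _ ≤ _ := by gcongr

theorem poly_gauss_bounded (c : ℂ) (p : Polynomial ℂ) (k : ℕ) : ∃ C : ℝ, ∀ t : ℝ,
    |t| ^ k * ‖p.eval (t : ℂ) * Complex.exp (-Real.pi * (t : ℂ) ^ 2 + c * t)‖ ≤ C := by
  induction p using Polynomial.induction_on' with
  | add p q hp hq =>
    obtain ⟨C, hC⟩ := hp
    obtain ⟨D, hD⟩ := hq
    refine ⟨C + D, fun t => ?_⟩
    rw [Polynomial.eval_add, add_mul]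
    calc _ ≤ |t| ^ k * (_ + _) := by gcongr; exact norm_add_le _ _
      _ ≤ C + D := by rw [mul_add]; exact add_le_add (hC t) (hD t)
  | monomial n a =>
    obtain ⟨C, hC⟩ := pow_mul_gauss_bounded c (k + n)
    refine ⟨‖a‖ * C, fun t => ?_⟩
    rw [Polynomial.eval_monomial, norm_mul, norm_mul, norm_pow, Complex.norm_real,
      Real.norm_eq_abs]
    calc _ = ‖a‖ * (|t| ^ (k + n) * ‖Complex.exp (-Real.pi * (t : ℂ) ^ 2 + c * t)‖) := by
            rw [pow_add]; ring
      _ ≤ _ := by gcongr; exact hC t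

/-- `t ↦ e^{-π t² + c t}` as a Schwartz function. -/
def gaussSchwartz (c : ℂ) : 𝓢(ℝ, ℂ) where
  toFun := fun t : ℝ => Complex.exp (-Real.pi * (t : ℂ) ^ 2 + c * t)
  smooth' := by
    have h : ContDiff ℝ (⊤ : ℕ∞) (fun t : ℝ => (t : ℂ)) := Complex.ofRealCLM.contDiff
    fun_prop
  decay' := by
    intro k n
    obtain ⟨p, hp⟩ := iteratedDeriv_gauss c n
    obtain ⟨C, hC⟩ := poly_gauss_bounded c p k
    refine ⟨C, fun t => ?_⟩
    rw [norm_iteratedFDeriv_eq_norm_iteratedDeriv, hp, Real.norm_eq_abs]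
    exact hC t

theorem exists_atom (z : ℂ) : ∃ φ : 𝓢(ℝ, ℂ), (φ : ℝ → ℂ) = atomFun z := by
  obtain ⟨K, hK⟩ := atomFun_eq z
  refine ⟨K • gaussSchwartz (2 * Real.pi * z.re - 2 * Complex.I * Real.pi * z.im), ?_⟩
  funext t
  rw [hK t]
  rfl

/-- The function `t ↦ g(t - τ) e^{-2 i π ω t}` as a Schwartz function. -/
def atom (z : ℂ) : 𝓢(ℝ, ℂ) where
  toFun := atomFun z
  smooth' := by
    obtain ⟨φ, hφ⟩ := exists_atom z
    exact hφ ▸ φ.smooth'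
  decay' := by
    obtain ⟨φ, hφ⟩ := exists_atom z
    exact hφ ▸ φ.decay'

/-! ### Noise, noisy spectrogram, intensity of zeros -/

/-- `ξ` is a complex white Gaussian noise on `ℝ`: a random tempered distribution with
characteristic functional `E[exp(i Re ⟨ξ, φ⟩)] = exp(-‖φ‖²_{L²} / 4)`.  Equivalently the `⟨ξ, φ⟩` are
jointly circular complex Gaussian with `E|⟨ξ, φ⟩|² = ‖φ‖²_{L²}`. -/
structure IsComplexWhiteNoise {Ω : Type*} [MeasurableSpace Ω] (P : Measure Ω)
    (ξ : Ω → 𝓢'(ℝ, ℂ)) : Prop where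
  measurable : ∀ φ : 𝓢(ℝ, ℂ), Measurable fun ω => ξ ω φ
  charFunctional : ∀ φ : 𝓢(ℝ, ℂ),
    ∫ ω, Complex.exp (Complex.I * ((ξ ω φ).re : ℂ)) ∂P =
      Complex.exp (-((∫ t : ℝ, ‖φ t‖ ^ 2 : ℝ) : ℂ) / 4)

/-- The spectrogram `Spec_g(x + T)(z)` of the sum of a function `x` and a tempered distribution `T`:
the squared modulus of the pairing of `x + T` with the atom at `z`. -/
def noisySpectrogram (x : ℝ → ℂ) (T : 𝓢'(ℝ, ℂ)) (z : ℂ) : ℝ := ‖stft x z + T (atom z)‖ ^ 2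

/-- The number `N(A)` of zeros in `A ⊆ ℂ` of a function on `ℂ`. -/
def zeroCount (S : ℂ → ℝ) (A : Set ℂ) : ℕ∞ := {z ∈ A | S z = 0}.encard

/-- `ρ : ℂ → [0, ∞)` is an intensity function of the zeros of the random function `S`, that is,
a density of `E[N(·)]` with respect to Lebesgue measure: for bounded Borel `A`, `N(A)` is a random
variable and `E[N(A)] = ∫_A ρ(z) dz`. -/
structure IsZeroIntensity {Ω : Type*} [MeasurableSpace Ω] (P : Measure Ω)
    (S : Ω → ℂ → ℝ) (ρ : ℂ → ℝ) : Prop where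
  measurable : Measurable ρ
  nonneg : ∀ z, 0 ≤ ρ z
  aemeasurable_count : ∀ A : Set ℂ, MeasurableSet A → Bornology.IsBounded A →
    AEMeasurable (fun ω => (zeroCount (S ω) A : ENNReal)) P
  expected_count : ∀ A : Set ℂ, MeasurableSet A → Bornology.IsBounded A →
    ∫⁻ ω, (zeroCount (S ω) A : ENNReal) ∂P = ∫⁻ z in A, ENNReal.ofReal (ρ z)

/-! ### The pair of parallel chirps -/

/-- `x(t) = √γ₁ e^{2iπt(a₁ + bt)} + √γ₂ e^{2iπt(a₂ + bt)}`. -/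
def chirpPair (γ₁ γ₂ a₁ a₂ b : ℝ) (t : ℝ) : ℂ :=
  (Real.sqrt γ₁ : ℂ) * Complex.exp (2 * Complex.I * Real.pi * t * (a₁ + b * t)) +
    (Real.sqrt γ₂ : ℂ) * Complex.exp (2 * Complex.I * Real.pi * t * (a₂ + b * t))

/-- `σ_b = √(2 / (1 + 4b²))`. -/
def sigma (b : ℝ) : ℝ := Real.sqrt (2 / (1 + 4 * b ^ 2))

/-- The signed distance `a` between the axes of the chirps. -/
def axisDist (a₁ a₂ b : ℝ) : ℝ := sigma b / Real.sqrt 2 * (a₂ - a₁)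

/-- The rotated coordinate `r` of `z = τ + iω`. -/
def rCoord (a₁ b : ℝ) (z : ℂ) : ℝ := sigma b / Real.sqrt 2 * (z.im - 2 * b * z.re - a₁)

/-- The rotated coordinate `s` of `z = τ + iω`. -/
def sCoord (a₁ a₂ b : ℝ) (z : ℂ) : ℝ :=
  sigma b / Real.sqrt 2 * (z.re + 2 * b * z.im - (a₁ + a₂) * b)

/-- The expression of the spectrogram of the pair of chirps in the rotated coordinates. -/
def specRS (γ₁ γ₂ a₁ a₂ b r s : ℝ) : ℝ :=
  let a := axisDist a₁ a₂ b
  sigma b * (γ₁ * Real.exp (-2 * Real.pi * r ^ 2) + γ₂ * Real.exp (-2 * Real.pi * (r - a) ^ 2) +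
    2 * Real.sqrt (γ₁ * γ₂) * Real.exp (-Real.pi * r ^ 2 - Real.pi * (r - a) ^ 2) *
      Real.cos (2 * Real.pi * a * s))

/-- The intensity of the zeros of the noisy pair of chirps in the rotated coordinates. -/
def rhoRS (γ₁ γ₂ a₁ a₂ b r s : ℝ) : ℝ :=
  let a := axisDist a₁ a₂ b
  Real.exp (-specRS γ₁ γ₂ a₁ a₂ b r s) *
    (1 + 4 * Real.pi * sigma b *
      (γ₁ * r ^ 2 * Real.exp (-2 * Real.pi * r ^ 2) +
        γ₂ * (r - a) ^ 2 * Real.exp (-2 * Real.pi * (r - a) ^ 2) +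
        2 * Real.sqrt (γ₁ * γ₂) * r * (r - a) *
          Real.exp (-Real.pi * r ^ 2 - Real.pi * (r - a) ^ 2) * Real.cos (2 * Real.pi * a * s)))

end NoisyChirps

end

noncomputable section

namespace NoisyChirps

/-! ### The area formula for entire functions -/

/-! Up to a nowhere vanishing factor, the Gaussian-window transform of `x + ξ` at `z` is an entire
function of `w = conj z`, namely `F w = m w + ξ (bargmannAtom w)`, where `m` is the Bargmann
transform of the signal and the noise part has covariance `exp (π w conj v)`, the Bargmann–Fock
kernel. The zeros of the spectrogram are therefore the conjugates of the zeros of a Gaussian entire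
function with mean `m`.

The intensity comes from a Kac–Rice formula obtained without conditioning on the value of `F`. Since
the kernel equals 1 when one argument is 0, the standard complex Gaussian `X = ξ (bargmannAtom 0)`
is independent of `Y = F - X`. For fixed `Y`, zeros of `X + Y` are solutions of `-Y w = X`, and
averaging their number over `X` with the area formula gives the integral of `π⁻¹ exp (-|Y|²) |Y'|²`
(`area_formula`, `expected_count_add`). The expectation over `Y` is a two-variable Gaussian integral
(`lintegral_exp_normSq_mul_normSq`). With `s = exp (π |w|²)` it equals `exp (-|m|² / s) (1 + |m' - π
conj w m|² / (π s))`.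

For chirps, `m` is a sum of two Gaussian exponentials, and `m' - π conj w m` multiplies each by its
own rotated coordinate, `r` or `r - a`, times a common constant of modulus `2π`
(`chirpPairDeriv_sub`). Hence one computation, `normSq_combination`, yields both the spectrogram and
the second factor of `ρ`. The formula on open sets passes to bounded Borel sets by a π-λ argument.
-/

open Set TopologicalSpace in
theorem exists_seq_basis : ∃ b : ℕ → Set ℂ, (∀ n, IsOpen (b n)) ∧
    ∀ (U : Set ℂ) (w : ℂ), IsOpen U → w ∈ U → ∃ n, w ∈ b n ∧ b n ⊆ U := by
  obtain ⟨B₀, hB₀, -⟩ := (isBasis_countableBasis ℂ).exists_subset_of_mem_open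
    (mem_univ (0 : ℂ)) isOpen_univ
  obtain ⟨b, hb⟩ := (countable_countableBasis ℂ).exists_eq_range ⟨B₀, hB₀⟩
  refine ⟨b, fun n => isOpen_of_mem_countableBasis (hb ▸ mem_range_self n), fun U w hU hw => ?_⟩
  obtain ⟨B, hB, hwB, hBs⟩ := (isBasis_countableBasis ℂ).exists_subset_of_mem_open hw hU
  rw [hb] at hB
  obtain ⟨n, rfl⟩ := hB
  exact ⟨n, hwB, hBs⟩

-- The regular points split into countably many Borel pieces on which `f` is injective, and the
-- change of variables has Jacobian `|f'|²` on each. Critical points contribute 0 on the left, and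
-- on the right their image is null by Sard's theorem.
open Set TopologicalSpace in
theorem area_formula {f : ℂ → ℂ} (hf : Differentiable ℂ f) {A : Set ℂ} (hA : MeasurableSet A)
    {h : ℂ → ENNReal} (hh : Measurable h) :
    ∫⁻ w in A, h (f w) * ENNReal.ofReal (‖deriv f w‖ ^ 2) =
      ∫⁻ ζ, h ζ * Measure.count {w ∈ A | f w = ζ} := by
  have hder : ∀ w, HasFDerivAt f ((deriv f w • (1 : ℂ →L[ℂ] ℂ)).restrictScalars ℝ) w := by
    intro w
    have h1 := (hf w).hasDerivAt.hasFDerivAt.restrictScalars ℝ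
    have h2 : deriv f w • (1 : ℂ →L[ℂ] ℂ) =
        ContinuousLinearMap.toSpanSingleton ℂ (deriv f w) := by ext; simp
    rw [h2]
    exact h1
  have hdet : ∀ c : ℂ, |((c • (1 : ℂ →L[ℂ] ℂ)).restrictScalars ℝ).det| = ‖c‖ ^ 2 := by
    intro c
    have : ((c • (1 : ℂ →L[ℂ] ℂ)).restrictScalars ℝ).det = ‖c‖ ^ 2 := by
      rw [ContinuousLinearMap.det, ← LinearMap.det_toMatrix Complex.basisOneI, Matrix.det_fin_two]
      simp [LinearMap.toMatrix_apply, Complex.sq_norm, Complex.normSq_apply]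
    rw [this, abs_of_nonneg (by positivity)]
  have hcd : Continuous (deriv f) := (hf.contDiff (n := 2)).continuous_deriv (by norm_num)
  have hmeas : MeasurableSet {w | deriv f w ≠ 0} := (hcd.measurable (measurableSet_singleton 0)).compl
  obtain ⟨b, hbo, hb⟩ := exists_seq_basis
  classical
  -- Only basic sets on which `f` is injective are kept; by the inverse function theorem they still
  -- cover the regular points.
  let V : ℕ → Set ℂ := fun n => if InjOn f (b n) then b n else ∅
  have hVo : ∀ n, MeasurableSet (V n) := by
    intro n
    by_cases h' : InjOn f (b n)
    · simp [V, h', (hbo n).measurableSet]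
    · simp [V, h']
  have hVi : ∀ n, InjOn f (V n) := by
    intro n
    by_cases h' : InjOn f (b n)
    · simp [V, h']
    · simp [V, h']
  have hVc : ∀ w, deriv f w ≠ 0 → ∃ n, w ∈ V n := by
    intro w hw
    have hs : HasStrictDerivAt f (deriv f w) w :=
      (hf.contDiff (n := 1)).contDiffAt.hasStrictDerivAt one_ne_zero
    have hs' := hs.hasStrictFDerivAt_equiv hw
    have hmem := hs'.mem_toOpenPartialHomeomorph_source
    obtain ⟨n, hwB, hBs⟩ := hb _ w (hs'.toOpenPartialHomeomorph f).open_source hmem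
    have hi : InjOn f (b n) := (hs'.toOpenPartialHomeomorph f).injOn.mono hBs
    exact ⟨n, by simp [V, hi, hwB]⟩
  let D : ℕ → Set ℂ := fun n => (A ∩ {w | deriv f w ≠ 0}) ∩ disjointed V n
  have hDm : ∀ n, MeasurableSet (D n) := fun n =>
    (hA.inter hmeas).inter (MeasurableSet.disjointed hVo n)
  have hDd : Pairwise (Function.onFun Disjoint D) := fun i j hij =>
    (disjoint_disjointed V hij).mono inter_subset_right inter_subset_right
  have hDi : ∀ n, InjOn f (D n) := fun n =>
    (hVi n).mono (inter_subset_right.trans (disjointed_subset V n))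
  have hDu : ⋃ n, D n = A ∩ {w | deriv f w ≠ 0} := by
    rw [← inter_iUnion, iUnion_disjointed, inter_eq_left]
    exact fun w hw => mem_iUnion.2 (hVc w hw.2)
  have hcrit : volume (f '' {w | deriv f w = 0}) = 0 :=
    addHaar_image_eq_zero_of_det_fderivWithin_eq_zero volume
      (fun w _ => (hder w).hasFDerivWithinAt) (fun w hw => by
        rw [← abs_eq_zero, hdet, show deriv f w = 0 from hw]; simp)
  have hleft : ∫⁻ w in A, h (f w) * ENNReal.ofReal (‖deriv f w‖ ^ 2) =
      ∑' n, ∫⁻ w in D n, h (f w) * ENNReal.ofReal (‖deriv f w‖ ^ 2) := by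
    rw [← lintegral_iUnion hDm hDd, hDu, ← lintegral_inter_add_sdiff _ A hmeas]
    convert add_zero _
    rw [setLIntegral_congr_fun (g := fun _ => 0) (hA.diff hmeas), lintegral_zero]
    intro w hw
    have : deriv f w = 0 := by simpa using hw.2
    simp [this]
  have hright : ∀ᵐ ζ, Measure.count {w ∈ A | f w = ζ} = ∑' n, (f '' D n).indicator 1 ζ := by
    filter_upwards [measure_eq_zero_iff_ae_notMem.1 hcrit] with ζ hζ
    have h1 : {w ∈ A | f w = ζ} = ⋃ n, (D n ∩ f ⁻¹' {ζ}) := by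
      rw [← iUnion_inter, hDu]
      ext w
      simp only [mem_ofPred_eq, mem_inter_iff, mem_preimage, mem_singleton_iff]
      constructor
      · rintro ⟨h1, h2⟩
        exact ⟨⟨h1, fun h3 => hζ ⟨w, h3, h2⟩⟩, h2⟩
      · rintro ⟨⟨h1, _⟩, h2⟩
        exact ⟨h1, h2⟩
    rw [h1, measure_iUnion (fun i j hij => (hDd hij).mono inter_subset_left inter_subset_left)
      (fun n => (hDm n).inter (hf.continuous.measurable (measurableSet_singleton ζ)))]
    congr 1
    ext n
    by_cases hn : ζ ∈ f '' D n
    · obtain ⟨w, hw, rfl⟩ := hn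
      have h2 : D n ∩ f ⁻¹' {f w} = {w} := by
        ext v
        simp only [mem_inter_iff, mem_preimage, mem_singleton_iff]
        exact ⟨fun hv => hDi n hv.1 hw hv.2, by rintro rfl; exact ⟨hw, rfl⟩⟩
      rw [h2, Measure.count_singleton, indicator_of_mem (mem_image_of_mem f hw)]
      rfl
    · rw [indicator_of_notMem hn]
      have h2 : D n ∩ f ⁻¹' {ζ} = ∅ := by
        ext v
        simp only [mem_inter_iff, mem_preimage, mem_singleton_iff, mem_empty_iff_false, iff_false]
        exact fun hv => hn ⟨v, hv.1, hv.2⟩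
      rw [h2, measure_empty]
  have him : ∀ n, MeasurableSet (f '' D n) := fun n =>
    measurable_image_of_fderivWithin (hDm n) (fun w _ => (hder w).hasFDerivWithinAt) (hDi n)
  rw [hleft, lintegral_congr_ae (g := fun ζ => ∑' n, h ζ * (f '' D n).indicator 1 ζ)
    (hright.mono fun ζ hζ => by simp only [hζ, ENNReal.tsum_mul_left]), lintegral_tsum]
  swap
  · exact fun n => (hh.mul (measurable_one.indicator (him n))).aemeasurable
  congr 1
  ext n
  have h3 := lintegral_image_eq_lintegral_abs_det_fderiv_mul volume (hDm n)
    (fun w _ => (hder w).hasFDerivWithinAt) (hDi n) h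
  simp only [hdet] at h3
  rw [← lintegral_indicator (him n)] at h3
  simp_rw [mul_comm (h _)]
  rw [← h3]
  congr 1
  ext ζ
  by_cases hn : ζ ∈ f '' D n <;> simp [hn]

/-! ### Counting the zeros of continuous functions in a measurable way -/

open Set TopologicalSpace in
/-- The number of zeros in an open set `A` of a continuous function is measurable
in the values of the function. -/
theorem exists_measurable_count {A : Set ℂ} (hA : IsOpen A) :
    ∃ Φ : (ℂ → ℂ) → ENNReal, Measurable Φ ∧
      ∀ f : ℂ → ℂ, Continuous f → Φ f = Measure.count {w ∈ A | f w = 0} := by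
  classical
  obtain ⟨b, hbo, hb⟩ := exists_seq_basis
  -- This condition reads `f` at countably many points only, hence is measurable for the product
  -- σ-algebra. For continuous `f` and compact `closure (b n)` it says that `f` vanishes somewhere
  -- on the closure.
  let Z : ℕ → Set (ℂ → ℂ) := fun n =>
    {f | ∀ m : ℕ, ∃ j : ℕ, denseSeq ℂ j ∈ b n ∧ ‖f (denseSeq ℂ j)‖ < 1 / ((m : ℝ) + 1)}
  have hZm : ∀ n, MeasurableSet (Z n) := by
    intro n
    have : Z n = ⋂ m : ℕ, ⋃ j : ℕ, ({f | denseSeq ℂ j ∈ b n} ∩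
        {f | ‖f (denseSeq ℂ j)‖ < 1 / ((m : ℝ) + 1)}) := by
      ext f; simp [Z]
    rw [this]
    refine MeasurableSet.iInter fun m => MeasurableSet.iUnion fun j => ?_
    exact (MeasurableSet.const _).inter
      (measurableSet_lt (measurable_pi_apply _).norm measurable_const)
  have hZ : ∀ f : ℂ → ℂ, Continuous f → ∀ n, IsCompact (closure (b n)) →
      (f ∈ Z n ↔ ∃ w ∈ closure (b n), f w = 0) := by
    intro f hf n hc
    constructor
    · intro h
      have hne : (closure (b n)).Nonempty := by
        obtain ⟨j, hj, -⟩ := h 0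
        exact ⟨_, subset_closure hj⟩
      obtain ⟨w, hw, hmin⟩ := hc.exists_isMinOn hne hf.norm.continuousOn
      refine ⟨w, hw, norm_le_zero_iff.1 (le_of_forall_pos_le_add fun ε hε => ?_)⟩
      obtain ⟨m, hm⟩ := exists_nat_one_div_lt hε
      obtain ⟨j, hj, hlt⟩ := h m
      have := isMinOn_iff.1 hmin _ (subset_closure hj)
      linarith
    · rintro ⟨w, hw, h0⟩ m
      have hop : IsOpen {v | ‖f v‖ < 1 / ((m : ℝ) + 1)} := isOpen_lt hf.norm continuous_const
      have hne := mem_closure_iff.1 hw _ hop (by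
        simp only [mem_ofPred_eq, h0, norm_zero]; positivity)
      obtain ⟨v, ⟨hv1, hv2⟩, j, rfl⟩ := (denseRange_denseSeq ℂ).inter_open_nonempty _
        (hop.inter (hbo n)) hne
      exact ⟨j, hv2, hv1⟩
  -- Disjoint closures inside `A` give a lower bound for the number of zeros: one for each closure
  -- that contains a zero. Any finite set of zeros is separated by such a family, so the supremum is
  -- the exact count.
  let good : Set (Finset ℕ) := {S | (∀ n ∈ S, IsCompact (closure (b n)) ∧ closure (b n) ⊆ A) ∧
    (S : Set ℕ).PairwiseDisjoint fun n => closure (b n)}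
  refine ⟨fun f => ⨆ S ∈ good, ∑ n ∈ S, (Z n).indicator 1 f, ?_, ?_⟩
  · refine Measurable.iSup fun S => Measurable.iSup fun _ => ?_
    exact Finset.measurable_fun_sum _ fun n _ => measurable_one.indicator (hZm n)
  · intro f hf
    have hzm : ∀ B : Set ℂ, MeasurableSet B → MeasurableSet {w ∈ B | f w = 0} := fun B hB =>
      hB.inter (hf.measurable (measurableSet_singleton 0))
    apply le_antisymm
    · refine iSup₂_le fun S hS => ?_
      calc ∑ n ∈ S, (Z n).indicator 1 f
          ≤ ∑ n ∈ S, Measure.count {w ∈ closure (b n) | f w = 0} := by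
            refine Finset.sum_le_sum fun n hn => ?_
            by_cases hfn : f ∈ Z n
            · obtain ⟨w, hw, h0⟩ := (hZ f hf n (hS.1 n hn).1).1 hfn
              rw [indicator_of_mem hfn]
              calc (1 : (ℂ → ℂ) → ENNReal) f = Measure.count {w} := by
                    rw [Measure.count_singleton]; rfl
                _ ≤ _ := measure_mono (singleton_subset_iff.2
                  (show w ∈ {w ∈ closure (b n) | f w = 0} from ⟨hw, h0⟩))
            · rw [indicator_of_notMem hfn]; exact zero_le
        _ = Measure.count (⋃ n ∈ S, {w ∈ closure (b n) | f w = 0}) := by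
            rw [measure_biUnion_finset]
            · exact fun i hi j hj hij => (hS.2 hi hj hij).mono (sep_subset _ _) (sep_subset _ _)
            · exact fun n _ => hzm _ isClosed_closure.measurableSet
        _ ≤ _ := measure_mono (iUnion₂_subset fun n hn w hw =>
            show w ∈ {w ∈ A | f w = 0} from ⟨(hS.1 n hn).2 hw.1, hw.2⟩)
    · rw [Measure.count_apply (hzm A hA.measurableSet)]
      have key : ∀ F : Finset ℂ, (F : Set ℂ) ⊆ {w ∈ A | f w = 0} →
          (F.card : ENNReal) ≤ ⨆ S ∈ good, ∑ n ∈ S, (Z n).indicator 1 f := by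
        intro F hF
        obtain ⟨U, hU, hUd⟩ := F.finite_toSet.t2_separation
        have : ∀ w : ℂ, ∃ n, w ∈ F → w ∈ b n ∧ IsCompact (closure (b n)) ∧
            closure (b n) ⊆ A ∩ U w := by
          intro w
          by_cases hw : w ∈ F
          · obtain ⟨r, hr, hrs⟩ := Metric.nhds_basis_closedBall.mem_iff.1
              ((hA.inter (hU w).2).mem_nhds ⟨(hF hw).1, (hU w).1⟩)
            obtain ⟨n, hwB, hBs⟩ := hb _ w Metric.isOpen_ball (Metric.mem_ball_self hr)
            have hcl : closure (b n) ⊆ Metric.closedBall w r :=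
              (closure_mono hBs).trans Metric.closure_ball_subset_closedBall
            exact ⟨n, fun _ => ⟨hwB, (isCompact_closedBall w r).of_isClosed_subset
              isClosed_closure hcl, hcl.trans hrs⟩⟩
          · exact ⟨0, fun h => absurd h hw⟩
        choose n hn using this
        have hinj : Set.InjOn n F := by
          intro w hw v hv hwv
          by_contra hne
          refine Set.disjoint_left.1 (hUd hw hv hne) ((hn w hw).2.2 (subset_closure (hn w hw).1)).2
            ((hn v hv).2.2 (subset_closure ?_)).2
          rw [← hwv]
          exact (hn w hw).1
        refine le_trans ?_ (le_iSup₂ (f := fun (S : Finset ℕ) (_ : S ∈ good) =>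
          ∑ n ∈ S, (Z n).indicator (1 : (ℂ → ℂ) → ENNReal) f) (F.image n) ⟨?_, ?_⟩)
        · rw [Finset.sum_image hinj]
          calc (F.card : ENNReal) = ∑ w ∈ F, 1 := by simp
            _ ≤ _ := Finset.sum_le_sum fun w hw => by
              rw [indicator_of_mem]
              · rfl
              · exact (hZ f hf _ (hn w hw).2.1).2 ⟨w, subset_closure (hn w hw).1, (hF hw).2⟩
        · intro k hk
          obtain ⟨w, hw, rfl⟩ := Finset.mem_image.1 hk
          exact ⟨(hn w hw).2.1, (hn w hw).2.2.trans inter_subset_left⟩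
        · intro k hk l hl hkl
          obtain ⟨w, hw, rfl⟩ := Finset.mem_image.1 (Finset.mem_coe.1 hk)
          obtain ⟨v, hv, rfl⟩ := Finset.mem_image.1 (Finset.mem_coe.1 hl)
          have hne : w ≠ v := fun h => hkl (by rw [h])
          exact (hUd hw hv hne).mono ((hn w hw).2.2.trans inter_subset_right)
            ((hn v hv).2.2.trans inter_subset_right)
      by_cases hfin : {w ∈ A | f w = 0}.Finite
      · have := key hfin.toFinset (by simp)
        rwa [hfin.encard_eq_coe_toFinset_card]
      · refine le_of_eq_of_le ?_ (le_of_forall_lt fun c hc => ?_) (b := ⊤)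
        · rw [Set.Infinite.encard_eq hfin]; rfl
        · obtain ⟨k, hk⟩ := ENNReal.exists_nat_gt hc.ne
          obtain ⟨F, hF, hcard⟩ := Set.Infinite.exists_subset_card_eq hfin k
          exact hk.trans_le (hcard ▸ key F hF)

open ProbabilityTheory in
/-- Expected number of zeros in an open set of the random entire function `X + Y`, where the
constant `X` is standard complex Gaussian and independent of `Y`. -/
theorem expected_count_add {Ω : Type*} [MeasurableSpace Ω] {P : Measure Ω}
    [IsProbabilityMeasure P] {X : Ω → ℂ} {Y : Ω → ℂ → ℂ} (hX : Measurable X)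
    (hXlaw : P.map X = volume.withDensity
      fun ζ => ENNReal.ofReal (Real.pi⁻¹ * Real.exp (-‖ζ‖ ^ 2)))
    (hY : ∀ ω, Differentiable ℂ (Y ω)) (hYm : ∀ w, Measurable fun ω => Y ω w)
    (hYm' : ∀ w, Measurable fun ω => deriv (Y ω) w)
    (hXY : IndepFun X Y P) {A : Set ℂ} (hA : IsOpen A) :
    Measurable (fun ω => Measure.count {w ∈ A | X ω + Y ω w = 0}) ∧
    ∫⁻ ω, Measure.count {w ∈ A | X ω + Y ω w = 0} ∂P =
      ∫⁻ w in A, ∫⁻ ω, ENNReal.ofReal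
        (Real.pi⁻¹ * Real.exp (-‖Y ω w‖ ^ 2) * ‖deriv (Y ω) w‖ ^ 2) ∂P := by
  obtain ⟨Φ, hΦ, hΦe⟩ := exists_measurable_count hA
  have hYmeas : Measurable Y := measurable_pi_iff.2 hYm
  let Ψ : ℂ × (ℂ → ℂ) → ENNReal := fun p => Φ fun w => p.1 + p.2 w
  have hΨ : Measurable Ψ := hΦ.comp (measurable_pi_iff.2 fun w =>
    measurable_fst.add ((measurable_pi_apply w).comp measurable_snd))
  have hΨe : ∀ ζ ω, Ψ (ζ, Y ω) = Measure.count {w ∈ A | ζ + Y ω w = 0} := fun ζ ω =>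
    hΦe _ (continuous_const.add (hY ω).continuous)
  have hρ : Measurable fun ζ : ℂ => ENNReal.ofReal (Real.pi⁻¹ * Real.exp (-‖ζ‖ ^ 2)) := by fun_prop
  have : IsProbabilityMeasure (P.map X) := Measure.isProbabilityMeasure_map hX.aemeasurable
  have : IsProbabilityMeasure (P.map Y) := Measure.isProbabilityMeasure_map hYmeas.aemeasurable
  simp_rw [← hΨe]
  refine ⟨hΨ.comp (hX.prodMk hYmeas), ?_⟩
  -- Independence allows integrating over `X` first, with the whole function `Y` frozen.
  have hjoint : P.map (fun ω => (X ω, Y ω)) = (P.map X).prod (P.map Y) :=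
    (indepFun_iff_map_prod_eq_prod_map_map hX.aemeasurable hYmeas.aemeasurable).1 hXY
  rw [← lintegral_map (f := Ψ) hΨ (hX.prodMk hYmeas), hjoint, lintegral_prod_symm _ hΨ.aemeasurable,
    lintegral_map hΨ.lintegral_prod_left' hYmeas, lintegral_lintegral_swap (μ := volume.restrict A)
      (f := fun w ω => ENNReal.ofReal
        (Real.pi⁻¹ * Real.exp (-‖Y ω w‖ ^ 2) * ‖deriv (Y ω) w‖ ^ 2))]
  · refine lintegral_congr fun ω => ?_
    have hΨω : Measurable fun ζ => Ψ (ζ, Y ω) := hΨ.comp (measurable_id.prodMk measurable_const)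
    rw [hXlaw, lintegral_withDensity_eq_lintegral_mul _ hρ hΨω]
    have hd : ∀ w, deriv (fun w => -Y ω w) w = -deriv (Y ω) w := fun w => deriv.fun_neg
    -- The weight `h` of the area formula is the density of `X`; the fibre of `-Y` over `ζ` is the
    -- zero set of `ζ + Y`.
    have harea := area_formula (f := fun w => -Y ω w) (hY ω).neg hA.measurableSet hρ
    simp only [hd, norm_neg] at harea
    simp only [Pi.mul_apply, hΨe]
    have h0 : ∀ w, ENNReal.ofReal (Real.pi⁻¹ * Real.exp (-‖Y ω w‖ ^ 2) * ‖deriv (Y ω) w‖ ^ 2) =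
        ENNReal.ofReal (Real.pi⁻¹ * Real.exp (-‖Y ω w‖ ^ 2)) *
          ENNReal.ofReal (‖deriv (Y ω) w‖ ^ 2) := fun w => ENNReal.ofReal_mul (by positivity)
    simp only [h0]
    rw [harea]
    refine lintegral_congr fun ζ => ?_
    congr 3
    ext w
    refine and_congr_right fun _ => ?_
    rw [neg_eq_iff_add_eq_zero, add_comm]
  · have hcd : ∀ ω, Continuous (deriv (Y ω)) := fun ω =>
      ((hY ω).contDiff (n := 2)).continuous_deriv (by norm_num)
    have h1 : Measurable (Function.uncurry fun w ω => Y ω w) :=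
      measurable_uncurry_of_continuous_of_measurable (u := fun w ω => Y ω w)
        (fun ω => (hY ω).continuous) hYm
    have h2 : Measurable (Function.uncurry fun w ω => deriv (Y ω) w) :=
      measurable_uncurry_of_continuous_of_measurable (u := fun w ω => deriv (Y ω) w) hcd hYm'
    refine Measurable.aemeasurable ?_
    have h3 : Measurable fun p : ℂ × Ω => ENNReal.ofReal
        (Real.pi⁻¹ * Real.exp (-‖Y p.2 p.1‖ ^ 2) * ‖deriv (Y p.2) p.1‖ ^ 2) :=
      ((measurable_const.mul (h1.norm.pow_const 2).neg.exp).mul (h2.norm.pow_const 2)).ennreal_ofReal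
    exact h3

/-! ### Laws of the pairings of a complex white noise with Schwartz functions -/

/-- The `L²` pairing `∫ φ ψ̄` of Schwartz functions. -/
def pairing (φ ψ : 𝓢(ℝ, ℂ)) : ℂ := ∫ t : ℝ, φ t * (starRingEnd ℂ) (ψ t)

theorem integrable_mul_conj (φ ψ : 𝓢(ℝ, ℂ)) :
    Integrable fun t : ℝ => φ t * (starRingEnd ℂ) (ψ t) := by
  have h1 : MemLp (fun t : ℝ => (starRingEnd ℂ) (ψ t)) 2 volume := (ψ.memLp 2 volume).star
  exact (φ.memLp 2 volume).integrable_mul h1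

theorem pairing_self (φ : 𝓢(ℝ, ℂ)) : pairing φ φ = (∫ t : ℝ, ‖φ t‖ ^ 2 : ℝ) := by
  rw [pairing, ← integral_complex_ofReal]
  refine integral_congr_ae (.of_forall fun t => ?_)
  simp [Complex.mul_conj']

theorem pairing_add_left (φ φ' ψ : 𝓢(ℝ, ℂ)) :
    pairing (φ + φ') ψ = pairing φ ψ + pairing φ' ψ := by
  rw [pairing, pairing, pairing, ← integral_add (integrable_mul_conj _ _) (integrable_mul_conj _ _)]
  refine integral_congr_ae (.of_forall fun t => ?_)
  simp [add_mul]

theorem pairing_smul_left (c : ℂ) (φ ψ : 𝓢(ℝ, ℂ)) :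
    pairing (c • φ) ψ = c * pairing φ ψ := by
  rw [pairing, pairing, ← integral_const_mul]
  refine integral_congr_ae (.of_forall fun t => ?_)
  simp [mul_assoc]

theorem pairing_conj_symm (φ ψ : 𝓢(ℝ, ℂ)) :
    (starRingEnd ℂ) (pairing φ ψ) = pairing ψ φ := by
  rw [pairing, pairing, ← integral_conj]
  refine integral_congr_ae (.of_forall fun t => ?_)
  simp [mul_comm]

theorem pairing_add_right (φ ψ ψ' : 𝓢(ℝ, ℂ)) :
    pairing φ (ψ + ψ') = pairing φ ψ + pairing φ ψ' := by
  rw [← pairing_conj_symm, pairing_add_left, map_add, pairing_conj_symm, pairing_conj_symm]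

theorem pairing_smul_right (c : ℂ) (φ ψ : 𝓢(ℝ, ℂ)) :
    pairing φ (c • ψ) = (starRingEnd ℂ) c * pairing φ ψ := by
  rw [← pairing_conj_symm, pairing_smul_left, map_mul, pairing_conj_symm]

theorem pairing_sub_left (φ φ' ψ : 𝓢(ℝ, ℂ)) :
    pairing (φ - φ') ψ = pairing φ ψ - pairing φ' ψ := by
  rw [sub_eq_add_neg, pairing_add_left, ← neg_one_smul ℂ, pairing_smul_left]
  ring

theorem pairing_sub_right (φ ψ ψ' : 𝓢(ℝ, ℂ)) :
    pairing φ (ψ - ψ') = pairing φ ψ - pairing φ ψ' := by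
  rw [← pairing_conj_symm, pairing_sub_left, map_sub, pairing_conj_symm, pairing_conj_symm]

open ProbabilityTheory

/-- Half of the square of the `L²` norm. -/
def halfNormSq (φ : 𝓢(ℝ, ℂ)) : NNReal :=
  ⟨(∫ t : ℝ, ‖φ t‖ ^ 2) / 2, by positivity⟩

theorem coe_halfNormSq (φ : 𝓢(ℝ, ℂ)) : (halfNormSq φ : ℝ) = (pairing φ φ).re / 2 := by
  rw [pairing_self, Complex.ofReal_re]
  rfl

variable {Ω : Type*} [MeasurableSpace Ω] {P : Measure Ω} [IsProbabilityMeasure P]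
  {ξ : Ω → 𝓢'(ℝ, ℂ)}

theorem map_re_apply (hξ : IsComplexWhiteNoise P ξ) (φ : 𝓢(ℝ, ℂ)) :
    P.map (fun ω => (ξ ω φ).re) = gaussianReal 0 (halfNormSq φ) := by
  have hm : Measurable fun ω => (ξ ω φ).re := Complex.measurable_re.comp (hξ.measurable φ)
  have : IsProbabilityMeasure (P.map fun ω => (ξ ω φ).re) :=
    Measure.isProbabilityMeasure_map hm.aemeasurable
  refine Measure.ext_of_charFun ?_
  ext t
  rw [charFun_gaussianReal, charFun_apply_real, integral_map hm.aemeasurable (by fun_prop)]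
  have h := hξ.charFunctional ((t : ℂ) • φ)
  have h1 : ∀ ω, Complex.exp (t * ((ξ ω φ).re : ℂ) * Complex.I) =
      Complex.exp (Complex.I * ((ξ ω ((t : ℂ) • φ)).re : ℂ)) := by
    intro ω
    rw [map_smul, smul_eq_mul, Complex.re_ofReal_mul]
    push_cast
    ring_nf
  have h2 : ((∫ s : ℝ, ‖((t : ℂ) • φ) s‖ ^ 2 : ℝ) : ℂ) = t ^ 2 * pairing φ φ := by
    rw [← pairing_self, pairing_smul_left, pairing_smul_right, Complex.conj_ofReal]
    ring
  simp_rw [h1, h, h2]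
  have h3 : ((halfNormSq φ : ℝ) : ℂ) = pairing φ φ / 2 := by
    rw [coe_halfNormSq, pairing_self]
    simp
  rw [h3]
  congr 1
  simp
  ring

/-- A real linear combination of real parts is the real part of a single pairing, so joint
Gaussianity reduces to `map_re_apply`. -/
theorem isGaussianProcess_re (hξ : IsComplexWhiteNoise P ξ) {S : Type*} (α : S → 𝓢(ℝ, ℂ)) :
    IsGaussianProcess (fun s ω => (ξ ω (α s)).re) P := by
  refine ⟨fun I => ⟨isGaussian_of_map_eq_gaussianReal fun L => ?_⟩⟩
  have hm : ∀ φ, Measurable fun ω => (ξ ω φ).re := fun φ =>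
    Complex.measurable_re.comp (hξ.measurable φ)
  classical
  let φ : 𝓢(ℝ, ℂ) := ∑ i : I, ((L (Pi.single i 1) : ℝ) : ℂ) • α i
  refine ⟨0, halfNormSq φ, ?_⟩
  rw [← map_re_apply hξ, Measure.map_map (by fun_prop)
    (show Measurable fun ω => I.restrict fun s => (ξ ω (α s)).re from
      measurable_pi_iff.2 fun i => hm _)]
  congr 1
  ext ω
  have hx : ∀ x : I → ℝ, L x = ∑ i, L (Pi.single i 1) * x i := by
    intro x
    conv_lhs => rw [← Finset.univ_sum_single x, map_sum]
    refine Finset.sum_congr rfl fun i _ => ?_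
    have : (Pi.single i (x i) : I → ℝ) = x i • Pi.single i 1 := by
      rw [← Pi.single_smul]; simp
    rw [this, map_smul, smul_eq_mul, mul_comm]
  have hφ : ξ ω φ = ∑ i : I, ((L (Pi.single i 1) : ℝ) : ℂ) * ξ ω (α i) := by
    rw [map_sum]
    exact Finset.sum_congr rfl fun i _ => map_smul _ _ _
  rw [Function.comp_apply, hx, hφ, Complex.re_sum]
  exact Finset.sum_congr rfl fun i _ => (Complex.re_ofReal_mul _ _).symm

theorem memLp_re (hξ : IsComplexWhiteNoise P ξ) (φ : 𝓢(ℝ, ℂ)) :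
    MemLp (fun ω => (ξ ω φ).re) 2 P := by
  have hm : Measurable fun ω => (ξ ω φ).re := Complex.measurable_re.comp (hξ.measurable φ)
  have h := memLp_id_gaussianReal' (μ := 0) (v := halfNormSq φ) 2 (by simp)
  rw [← map_re_apply hξ] at h
  exact (memLp_map_measure_iff (by fun_prop) hm.aemeasurable).1 h

theorem variance_re (hξ : IsComplexWhiteNoise P ξ) (φ : 𝓢(ℝ, ℂ)) :
    variance (fun ω => (ξ ω φ).re) P = (pairing φ φ).re / 2 := by
  have hm : Measurable fun ω => (ξ ω φ).re := Complex.measurable_re.comp (hξ.measurable φ)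
  rw [← coe_halfNormSq, ← variance_id_gaussianReal (μ := 0) (v := halfNormSq φ),
    ← map_re_apply hξ, variance_map (by fun_prop) hm.aemeasurable]
  rfl

theorem covariance_re (hξ : IsComplexWhiteNoise P ξ) (φ ψ : 𝓢(ℝ, ℂ)) :
    covariance (fun ω => (ξ ω φ).re) (fun ω => (ξ ω ψ).re) P = (pairing φ ψ).re / 2 := by
  have h := variance_fun_add (memLp_re hξ φ) (memLp_re hξ ψ)
  have h1 : (fun ω => (ξ ω φ).re + (ξ ω ψ).re) = fun ω => (ξ ω (φ + ψ)).re := by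
    ext ω; rw [map_add, Complex.add_re]
  rw [h1, variance_re hξ, variance_re hξ, variance_re hξ, pairing_add_left, pairing_add_right,
    pairing_add_right, ← pairing_conj_symm φ ψ] at h
  simp only [Complex.add_re, Complex.conj_re] at h
  linarith

theorem indepFun_re (hξ : IsComplexWhiteNoise P ξ) {S T : Type*} (α : S → 𝓢(ℝ, ℂ))
    (β : T → 𝓢(ℝ, ℂ)) (h : ∀ s t, (pairing (α s) (β t)).re = 0) :
    IndepFun (fun ω s => (ξ ω (α s)).re) (fun ω t => (ξ ω (β t)).re) P := by
  have hm : ∀ φ, AEMeasurable (fun ω => (ξ ω φ).re) P := fun φ =>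
    (Complex.measurable_re.comp (hξ.measurable φ)).aemeasurable
  refine IsGaussianProcess.indepFun_of_covariance_eq_zero (X := fun s ω => (ξ ω (α s)).re)
    (Y := fun t ω => (ξ ω (β t)).re) ?_ (fun s => hm _) (fun t => hm _) fun s t => ?_
  · convert isGaussianProcess_re hξ (Sum.elim α β) using 1
    ext (s | t) ω <;> rfl
  · rw [covariance_re hξ, h, zero_div]

theorem indepFun_apply (hξ : IsComplexWhiteNoise P ξ) {S T : Type*} (α : S → 𝓢(ℝ, ℂ))
    (β : T → 𝓢(ℝ, ℂ)) (h : ∀ s t, pairing (α s) (β t) = 0) :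
    IndepFun (fun ω s => ξ ω (α s)) (fun ω t => ξ ω (β t)) P := by
  -- The imaginary part of `ξ ω φ` is the real part of `ξ ω (-I • φ)`. Complex orthogonality makes
  -- all the real covariances between the two doubled families vanish.
  let c : Bool → ℂ := fun b => if b then 1 else -Complex.I
  have h1 := indepFun_re hξ (fun p : S × Bool => c p.2 • α p.1)
    (fun p : T × Bool => c p.2 • β p.1) fun s t => by
      rw [pairing_smul_left, pairing_smul_right, h]; simp
  have h2 := h1.comp
    (φ := fun (x : S × Bool → ℝ) s => (x (s, true) : ℂ) + x (s, false) * Complex.I)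
    (ψ := fun (x : T × Bool → ℝ) t => (x (t, true) : ℂ) + x (t, false) * Complex.I)
    (by fun_prop) (by fun_prop)
  have h3 : ∀ z : ℂ, ((c true * z).re : ℂ) + ((c false * z).re : ℂ) * Complex.I = z := by
    intro z
    simp [c, Complex.re_add_im]
  convert h2 using 1
  · ext ω s
    simp only [Function.comp_apply, map_smul, smul_eq_mul, h3]
  · ext ω s
    simp only [Function.comp_apply, map_smul, smul_eq_mul, h3]

/-- The real and imaginary parts of a pairing are independent centred real Gaussian variables. -/
theorem map_re_im_apply (hξ : IsComplexWhiteNoise P ξ) (φ : 𝓢(ℝ, ℂ)) :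
    P.map (fun ω => ((ξ ω φ).re, (ξ ω φ).im)) =
      (gaussianReal 0 (halfNormSq φ)).prod (gaussianReal 0 (halfNormSq φ)) := by
  have him : ∀ ω, (ξ ω φ).im = (ξ ω (-Complex.I • φ)).re := by intro ω; simp
  have hn : halfNormSq (-Complex.I • φ) = halfNormSq φ := by
    apply NNReal.coe_injective
    rw [coe_halfNormSq, coe_halfNormSq, pairing_smul_left, pairing_smul_right, ← mul_assoc]
    simp
  have h := indepFun_re hξ (fun _ : Unit => φ) (fun _ : Unit => -Complex.I • φ) fun _ _ => by
    rw [pairing_smul_right, pairing_self]; simp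
  have h' := h.comp (measurable_pi_apply ()) (measurable_pi_apply ())
  have hm : ∀ φ, AEMeasurable (fun ω => (ξ ω φ).re) P := fun φ =>
    (Complex.measurable_re.comp (hξ.measurable φ)).aemeasurable
  have h2 := (indepFun_iff_map_prod_eq_prod_map_map (hm φ) (hm (-Complex.I • φ))).1 h'
  simp_rw [him]
  rw [h2, map_re_apply hξ, map_re_apply hξ, hn]

theorem lintegral_apply (hξ : IsComplexWhiteNoise P ξ) (φ : 𝓢(ℝ, ℂ)) {g : ℂ → ENNReal}
    (hg : Measurable g) :
    ∫⁻ ω, g (ξ ω φ) ∂P = ∫⁻ p : ℝ × ℝ, g (p.1 + p.2 * Complex.I)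
      ∂((gaussianReal 0 (halfNormSq φ)).prod (gaussianReal 0 (halfNormSq φ))) := by
  rw [← map_re_im_apply hξ, lintegral_map (by fun_prop)]
  · simp [Complex.re_add_im]
  · exact (Complex.measurable_re.comp (hξ.measurable φ)).prodMk
      (Complex.measurable_im.comp (hξ.measurable φ))

theorem map_apply_of_norm_one (hξ : IsComplexWhiteNoise P ξ) {φ : 𝓢(ℝ, ℂ)}
    (hφ : pairing φ φ = 1) :
    P.map (fun ω => ξ ω φ) = volume.withDensity
      fun ζ => ENNReal.ofReal (Real.pi⁻¹ * Real.exp (-‖ζ‖ ^ 2)) := by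
  have hv : halfNormSq φ = 1 / 2 := by
    apply NNReal.coe_injective
    rw [coe_halfNormSq, hφ]; simp
  refine Measure.ext_of_lintegral _ fun g hg => ?_
  rw [lintegral_map hg (hξ.measurable φ), lintegral_apply hξ φ hg, hv,
    lintegral_withDensity_eq_lintegral_mul _ (by fun_prop) hg,
    gaussianReal_of_var_ne_zero _ (by simp), prod_withDensity (by fun_prop) (by fun_prop),
    lintegral_withDensity_eq_lintegral_mul _ (by fun_prop) (by fun_prop),
    ← Complex.volume_preserving_equiv_real_prod.symm.lintegral_comp_emb
      Complex.measurableEquivRealProd.symm.measurableEmbedding]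
  rw [← Measure.volume_eq_prod]
  refine lintegral_congr fun p => ?_
  have hp : Complex.measurableEquivRealProd.symm p = p.1 + p.2 * Complex.I := by
    apply Complex.ext <;> simp [Complex.measurableEquivRealProd]
  simp only [Pi.mul_apply, hp]
  congr 1
  rw [gaussianPDF, gaussianPDF, ← ENNReal.ofReal_mul (gaussianPDFReal_nonneg _ _ _)]
  congr 1
  rw [gaussianPDFReal, gaussianPDFReal, Complex.sq_norm, Complex.normSq_add_mul_I]
  have hs : (2 * Real.pi * ((1 / 2 : NNReal) : ℝ)) = Real.pi := by push_cast; ring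
  rw [hs]
  have hsq : (√Real.pi)⁻¹ * (√Real.pi)⁻¹ = Real.pi⁻¹ := by
    rw [← mul_inv, Real.mul_self_sqrt Real.pi_pos.le]
  rw [mul_mul_mul_comm, hsq, ← Real.exp_add]
  congr 2
  push_cast
  ring

/-! ### Tempered distributions applied to Gaussians are entire functions of the parameter -/

theorem gaussSchwartz_apply (c : ℂ) (t : ℝ) :
    gaussSchwartz c t = Complex.exp (-Real.pi * (t : ℂ) ^ 2 + c * t) := rfl

theorem hasDerivAt_gaussSchwartz (c : ℂ) (t : ℝ) :
    HasDerivAt (gaussSchwartz c) ((-2 * Real.pi * t + c) * gaussSchwartz c t) t := by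
  have h1 : HasDerivAt (fun w : ℂ => Complex.exp (-Real.pi * w ^ 2 + c * w))
      (Complex.exp (-Real.pi * (t : ℂ) ^ 2 + c * t) * (-Real.pi * (2 * (t : ℂ)) + c)) (t : ℂ) := by
    refine HasDerivAt.cexp ?_
    have ha := ((hasDerivAt_id (t : ℂ)).pow 2).const_mul (-Real.pi : ℂ)
    have hb := (hasDerivAt_id (t : ℂ)).const_mul c
    refine (ha.add hb).congr_deriv ?_
    simp
  refine h1.comp_ofReal.congr_deriv ?_
  rw [gaussSchwartz_apply]
  ring

/-- `t ↦ t e^{-π t² + c t}` as a Schwartz function. -/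
def mulGaussSchwartz (c : ℂ) : 𝓢(ℝ, ℂ) :=
  (2 * Real.pi : ℂ)⁻¹ • (c • gaussSchwartz c - SchwartzMap.derivCLM ℂ ℂ (gaussSchwartz c))

/-- Solves `g' = (c - 2πt) g` for `t g`, so the Schwartz property is inherited from `gaussSchwartz`.
-/
theorem mulGaussSchwartz_apply (c : ℂ) (t : ℝ) :
    mulGaussSchwartz c t = t * gaussSchwartz c t := by
  have hpi : (Real.pi : ℂ) ≠ 0 := by exact_mod_cast Real.pi_ne_zero
  simp only [mulGaussSchwartz, smul_apply, sub_apply,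
    SchwartzMap.derivCLM_apply, (hasDerivAt_gaussSchwartz c t).deriv, smul_eq_mul]
  field_simp
  ring

theorem iteratedDeriv_comp_ofReal {F : ℂ → ℂ} (hF : Differentiable ℂ F) (n : ℕ) :
    iteratedDeriv n (fun t : ℝ => F t) = fun t : ℝ => iteratedDeriv n F t := by
  induction n with
  | zero => simp
  | succ n ih =>
    rw [iteratedDeriv_succ, ih]
    funext t
    have h : DifferentiableAt ℂ (iteratedDeriv n F) t :=
      (hF.contDiff (n := (n + 1 : ℕ))).differentiable_iteratedDeriv n (by exact_mod_cast n.lt_succ_self) t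
    rw [h.hasDerivAt.comp_ofReal.deriv, iteratedDeriv_succ]

/-- The remainder is the restriction to `ℝ` of an entire function. Cauchy's estimate on the unit
circle around `x` replaces its `n`-th derivative by its size there, where `|Im z| ≤ 1` preserves the
Gaussian decay. -/
theorem seminorm_gaussSchwartz_remainder (c : ℂ) (k n : ℕ) : ∃ C : ℝ, 0 ≤ C ∧ ∀ h : ℂ, ‖h‖ ≤ 1 →
    SchwartzMap.seminorm ℂ k n
      (gaussSchwartz (c + h) - gaussSchwartz c - h • mulGaussSchwartz c) ≤ C * ‖h‖ ^ 2 := by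
  -- The exponents collected below add up to `2π + 1 + (‖c‖ + 2) r - π r²`, with `r = ‖z‖`;
  -- completing the square bounds this by the exponent of `D`.
  let D : ℝ := Real.exp (2 * Real.pi + 1 + (‖c‖ + 2) ^ 2)
  refine ⟨n.factorial * ((k + 2).factorial * D), by positivity, fun h hh => ?_⟩
  let F : ℂ → ℂ := fun t =>
    Complex.exp (-Real.pi * t ^ 2 + c * t) * (Complex.exp (h * t) - 1 - h * t)
  have hF : Differentiable ℂ F := by fun_prop
  have hFe : ((gaussSchwartz (c + h) - gaussSchwartz c - h • mulGaussSchwartz c : 𝓢(ℝ, ℂ)) :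
      ℝ → ℂ) = fun t : ℝ => F t := by
    funext t
    simp only [sub_apply, smul_apply, smul_eq_mul, mulGaussSchwartz_apply,
      gaussSchwartz_apply, F]
    rw [add_mul, ← add_assoc, Complex.exp_add]
    ring
  refine SchwartzMap.seminorm_le_bound' ℂ k n _ (by positivity) fun x => ?_
  rw [hFe, iteratedDeriv_comp_ofReal hF]
  have key : ∀ z ∈ Metric.sphere (x : ℂ) 1,
      |x| ^ k * ‖F z‖ ≤ (k + 2).factorial * D * ‖h‖ ^ 2 := by
    intro z hz
    have hz1 : ‖z - x‖ = 1 := mem_sphere_iff_norm.1 hz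
    set r := ‖z‖ with hr
    have hr0 : 0 ≤ r := norm_nonneg z
    have hx : |x| ≤ r + 1 := by
      have h1 : ‖(x : ℂ)‖ ≤ ‖z‖ + ‖z - x‖ := by
        have := norm_sub_le z (z - x)
        rwa [sub_sub_cancel] at this
      rw [Complex.norm_real, Real.norm_eq_abs] at h1
      linarith
    have him : |z.im| ≤ 1 := by
      have := Complex.abs_im_le_norm (z - x)
      rw [hz1] at this
      simpa using this
    have hre : (-Real.pi * z ^ 2 + c * z).re ≤ 2 * Real.pi - Real.pi * r ^ 2 + ‖c‖ * r := by
      have h1 : (z ^ 2).re = r ^ 2 - 2 * z.im ^ 2 := by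
        rw [hr, Complex.sq_norm, Complex.normSq_apply, pow_two, Complex.mul_re]; ring
      have h2 : (c * z).re ≤ ‖c‖ * r := by
        rw [hr, ← norm_mul]; exact Complex.re_le_norm _
      have h3 : z.im ^ 2 ≤ 1 := by rw [← sq_abs]; nlinarith [abs_nonneg z.im]
      have h4 : (-Real.pi * z ^ 2).re = -Real.pi * (z ^ 2).re := by
        rw [← Complex.ofReal_neg, Complex.re_ofReal_mul]
      rw [Complex.add_re, h4, h1]
      nlinarith [Real.pi_pos]
    have hrem : ‖Complex.exp (h * z) - 1 - h * z‖ ≤ (‖h‖ ^ 2 * r ^ 2) * Real.exp r := by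
      have h1 := Complex.norm_exp_sub_sum_le_norm_mul_exp (h * z) 2
      simp only [Finset.sum_range_succ, Finset.range_zero, Finset.sum_empty, pow_zero,
        Nat.factorial_zero, Nat.cast_one, div_one, zero_add, pow_one, Nat.factorial_one,
        norm_mul] at h1
      rw [← sub_sub] at h1
      refine h1.trans ?_
      rw [mul_pow]
      gcongr
      nlinarith [norm_nonneg z]
    have hpoly : (r + 1) ^ (k + 2) ≤ (k + 2).factorial * Real.exp (r + 1) := by
      have h1 := Real.pow_div_factorial_le_exp (r + 1) (by positivity) (k + 2)
      rw [div_le_iff₀ (by positivity)] at h1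
      linarith
    calc |x| ^ k * ‖F z‖ ≤ (r + 1) ^ k * (Real.exp (2 * Real.pi - Real.pi * r ^ 2 + ‖c‖ * r) *
          ((‖h‖ ^ 2 * (r + 1) ^ 2) * Real.exp r)) := by
          simp only [F, norm_mul]
          rw [Complex.norm_exp]
          gcongr
          refine hrem.trans ?_
          gcongr
          linarith
      _ = ((r + 1) ^ (k + 2) * Real.exp (2 * Real.pi - Real.pi * r ^ 2 + ‖c‖ * r + r)) *
          ‖h‖ ^ 2 := by
          rw [Real.exp_add _ r]; ring
      _ ≤ (((k + 2).factorial * Real.exp (r + 1)) *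
          Real.exp (2 * Real.pi - Real.pi * r ^ 2 + ‖c‖ * r + r)) * ‖h‖ ^ 2 := by
          gcongr
      _ ≤ (k + 2).factorial * D * ‖h‖ ^ 2 := by
          rw [mul_assoc ((k + 2).factorial : ℝ), ← Real.exp_add]
          gcongr
          refine Real.exp_le_exp.2 ?_
          have := Real.pi_gt_three
          nlinarith [sq_nonneg (r - (‖c‖ + 2)), sq_nonneg r, sq_nonneg (‖c‖ + 2)]
  have hCauchy := Complex.norm_iteratedDeriv_le_of_forall_mem_sphere_norm_le
    (f := fun z => ((|x| ^ k : ℝ) : ℂ) * F z) n one_pos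
    ((hF.const_mul _).diffContOnCl) (c := x) (C := (k + 2).factorial * D * ‖h‖ ^ 2) (by
      intro z hz
      rw [norm_mul, Complex.norm_real, Real.norm_of_nonneg (by positivity)]
      exact key z hz)
  rw [iteratedDeriv_const_mul_field, norm_mul, Complex.norm_real,
    Real.norm_of_nonneg (by positivity), one_pow, div_one] at hCauchy
  linarith

/-- Continuity of `T` bounds it by finitely many Schwartz seminorms, in each of which the Taylor
remainder is `O(‖h‖²)`. This makes every realization of the noise part holomorphic. -/
theorem hasDerivAt_apply_gaussSchwartz (T : 𝓢'(ℝ, ℂ)) (c : ℂ) :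
    HasDerivAt (fun c => T (gaussSchwartz c)) (T (mulGaussSchwartz c)) c := by
  obtain ⟨s, C, -, hC⟩ := Seminorm.bound_of_continuous (schwartz_withSeminorms ℂ ℝ ℂ)
    ((normSeminorm ℂ ℂ).comp (T : 𝓢(ℝ, ℂ) →ₗ[ℂ] ℂ)) (continuous_norm.comp T.continuous)
  choose K hK0 hK using seminorm_gaussSchwartz_remainder c
  rw [hasDerivAt_iff_isLittleO_nhds_zero]
  refine (Asymptotics.IsBigO.of_bound (C * ∑ i ∈ s, K i.1 i.2) ?_).trans_isLittleO
    (Asymptotics.isLittleO_pow_id one_lt_two)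
  filter_upwards [Metric.closedBall_mem_nhds (0 : ℂ) one_pos] with h hh
  rw [mem_closedBall_zero_iff] at hh
  rw [smul_eq_mul, ← smul_eq_mul h, ← map_smul, ← map_sub, ← map_sub, norm_pow]
  refine (hC _).trans ?_
  have hsum : 0 ≤ ∑ i ∈ s, K i.1 i.2 := Finset.sum_nonneg fun i _ => hK0 _ _
  have hle : (s.sup (schwartzSeminormFamily ℂ ℝ ℂ))
      (gaussSchwartz (c + h) - gaussSchwartz c - h • mulGaussSchwartz c) ≤
      (∑ i ∈ s, K i.1 i.2) * ‖h‖ ^ 2 := by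
    refine Seminorm.finset_sup_apply_le (by positivity) fun i hi => ?_
    refine (hK i.1 i.2 h hh).trans ?_
    gcongr
    exact Finset.single_le_sum (f := fun i : ℕ × ℕ => K i.1 i.2) (fun i _ => hK0 _ _) hi
  rw [mul_assoc]
  exact mul_le_mul_of_nonneg_left hle C.2

/-! ### A Gaussian integral -/

theorem integrable_gaussianReal_id (μ : ℝ) (v : NNReal) : Integrable (fun x => x) (gaussianReal μ v) :=
  (memLp_id_gaussianReal' 1 (by simp)).integrable le_rfl

theorem integrable_gaussianReal_sq (μ : ℝ) (v : NNReal) :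
    Integrable (fun x => x ^ 2) (gaussianReal μ v) :=
  (memLp_id_gaussianReal' 2 (by simp)).integrable_sq

theorem integral_gaussianReal_sq (μ : ℝ) (v : NNReal) :
    ∫ x, x ^ 2 ∂(gaussianReal μ v) = v + μ ^ 2 := by
  have h := variance_eq_sub (memLp_id_gaussianReal' (μ := μ) (v := v) 2 (by simp))
  rw [variance_id_gaussianReal] at h
  simp only [Pi.pow_apply, id, integral_id_gaussianReal] at h
  linarith

theorem lintegral_normSq_gaussian (c κ : ℂ) (μ₁ μ₂ : ℝ) (v₁ v₂ : NNReal) :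
    ∫⁻ p : ℝ × ℝ, ENNReal.ofReal (‖c + κ * (p.1 + p.2 * Complex.I)‖ ^ 2)
      ∂((gaussianReal μ₁ v₁).prod (gaussianReal μ₂ v₂)) =
    ENNReal.ofReal (‖c + κ * (μ₁ + μ₂ * Complex.I)‖ ^ 2 + ‖κ‖ ^ 2 * (v₁ + v₂)) := by
  set B : ℝ := 2 * (c.re * κ.re + c.im * κ.im) with hB
  set C : ℝ := 2 * (c.im * κ.re - c.re * κ.im) with hC
  have hexp : ∀ x y : ℝ, ‖c + κ * (x + y * Complex.I)‖ ^ 2 =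
      ‖c‖ ^ 2 + B * x + C * y + ‖κ‖ ^ 2 * x ^ 2 + ‖κ‖ ^ 2 * y ^ 2 := by
    intro x y
    simp only [Complex.sq_norm, Complex.normSq_apply, Complex.add_re, Complex.add_im,
      Complex.mul_re, Complex.mul_im, Complex.ofReal_re, Complex.ofReal_im, Complex.I_re,
      Complex.I_im, hB, hC]
    ring
  have i1 : Integrable (fun p : ℝ × ℝ => p.1) ((gaussianReal μ₁ v₁).prod (gaussianReal μ₂ v₂)) :=
    (integrable_gaussianReal_id μ₁ v₁).comp_fst _
  have i2 : Integrable (fun p : ℝ × ℝ => p.2) ((gaussianReal μ₁ v₁).prod (gaussianReal μ₂ v₂)) :=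
    (integrable_gaussianReal_id μ₂ v₂).comp_snd _
  have i3 : Integrable (fun p : ℝ × ℝ => p.1 ^ 2)
      ((gaussianReal μ₁ v₁).prod (gaussianReal μ₂ v₂)) :=
    (integrable_gaussianReal_sq μ₁ v₁).comp_fst _
  have i4 : Integrable (fun p : ℝ × ℝ => p.2 ^ 2)
      ((gaussianReal μ₁ v₁).prod (gaussianReal μ₂ v₂)) :=
    (integrable_gaussianReal_sq μ₂ v₂).comp_snd _
  have e1 : ∫ p : ℝ × ℝ, p.1 ∂((gaussianReal μ₁ v₁).prod (gaussianReal μ₂ v₂)) = μ₁ := by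
    rw [integral_fun_fst (fun x : ℝ => x)]; simp
  have e2 : ∫ p : ℝ × ℝ, p.2 ∂((gaussianReal μ₁ v₁).prod (gaussianReal μ₂ v₂)) = μ₂ := by
    rw [integral_fun_snd (fun x : ℝ => x)]; simp
  have e3 : ∫ p : ℝ × ℝ, p.1 ^ 2 ∂((gaussianReal μ₁ v₁).prod (gaussianReal μ₂ v₂)) =
      v₁ + μ₁ ^ 2 := by
    rw [integral_fun_fst (fun x : ℝ => x ^ 2), integral_gaussianReal_sq]; simp
  have e4 : ∫ p : ℝ × ℝ, p.2 ^ 2 ∂((gaussianReal μ₁ v₁).prod (gaussianReal μ₂ v₂)) =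
      v₂ + μ₂ ^ 2 := by
    rw [integral_fun_snd (fun x : ℝ => x ^ 2), integral_gaussianReal_sq]; simp
  rw [← ofReal_integral_eq_lintegral_ofReal]
  · congr 1
    simp only [hexp]
    rw [integral_add, integral_add, integral_add, integral_add, integral_const_mul,
      integral_const_mul, integral_const_mul, integral_const_mul, e1, e2, e3, e4]
    · simp
      ring
    all_goals fun_prop
  · simp only [hexp]
    fun_prop
  · exact .of_forall fun p => by positivity

/-- Completing the square: tilting a centred Gaussian by `exp (-(p + x)²)` gives a multiple of
another Gaussian. -/
theorem lintegral_exp_mul_gaussianReal (p : ℝ) {v : NNReal} (hv : v ≠ 0) {g : ℝ → ENNReal}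
    (hg : Measurable g) :
    ∫⁻ x, ENNReal.ofReal (Real.exp (-(p + x) ^ 2)) * g x ∂(gaussianReal 0 v) =
      ENNReal.ofReal (Real.exp (-p ^ 2 / (1 + 2 * v)) / √(1 + 2 * v)) *
        ∫⁻ x, g x ∂(gaussianReal (-(2 * v * p) / (1 + 2 * v)) (v / (1 + 2 * v))) := by
  have hv0 : (0 : ℝ) < v := by exact_mod_cast pos_iff_ne_zero.2 hv
  have hv' : v / (1 + 2 * v) ≠ 0 := by positivity
  rw [gaussianReal_of_var_ne_zero _ hv, gaussianReal_of_var_ne_zero _ hv',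
    lintegral_withDensity_eq_lintegral_mul _ (by fun_prop) (by fun_prop),
    lintegral_withDensity_eq_lintegral_mul _ (by fun_prop) hg, ← lintegral_const_mul _ (by fun_prop)]
  refine lintegral_congr fun x => ?_
  simp only [Pi.mul_apply]
  rw [← mul_assoc, ← mul_assoc]
  congr 1
  rw [gaussianPDF, gaussianPDF, ← ENNReal.ofReal_mul (gaussianPDFReal_nonneg _ _ _),
    ← ENNReal.ofReal_mul (by positivity)]
  congr 1
  rw [gaussianPDFReal, gaussianPDFReal]
  push_cast
  have hs : (0 : ℝ) < 1 + 2 * v := by positivity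
  have h1 : √(2 * Real.pi * (v / (1 + 2 * v))) = √(2 * Real.pi * v) / √(1 + 2 * v) := by
    rw [← mul_div_assoc, Real.sqrt_div (by positivity)]
  have h2 : -(x - 0) ^ 2 / (2 * v) + -(p + x) ^ 2 = -p ^ 2 / (1 + 2 * v) +
      -(x - -(2 * v * p) / (1 + 2 * v)) ^ 2 / (2 * (v / (1 + 2 * v))) := by
    field_simp
    ring
  rw [mul_assoc, ← Real.exp_add, h2, Real.exp_add, h1, inv_div]
  field_simp

theorem lintegral_exp_mul_gaussianReal_prod (m : ℂ) {v : NNReal} (hv : v ≠ 0)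
    {g : ℝ × ℝ → ENNReal} (hg : Measurable g) :
    ∫⁻ p : ℝ × ℝ, ENNReal.ofReal (Real.exp (-‖m + (p.1 + p.2 * Complex.I)‖ ^ 2)) * g p
      ∂((gaussianReal 0 v).prod (gaussianReal 0 v)) =
      ENNReal.ofReal (Real.exp (-‖m‖ ^ 2 / (1 + 2 * v)) / (1 + 2 * v)) *
        ∫⁻ p : ℝ × ℝ, g p ∂((gaussianReal (-(2 * v * m.re) / (1 + 2 * v)) (v / (1 + 2 * v))).prod
          (gaussianReal (-(2 * v * m.im) / (1 + 2 * v)) (v / (1 + 2 * v)))) := by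
  have hexp : ∀ x y : ℝ, ENNReal.ofReal (Real.exp (-‖m + (x + y * Complex.I)‖ ^ 2)) =
      ENNReal.ofReal (Real.exp (-(m.re + x) ^ 2)) * ENNReal.ofReal (Real.exp (-(m.im + y) ^ 2)) := by
    intro x y
    rw [← ENNReal.ofReal_mul (by positivity), ← Real.exp_add, Complex.sq_norm, Complex.normSq_apply]
    congr 2
    simp
    ring
  have hs : (0 : ℝ) < 1 + 2 * v := by positivity
  have hconst : ENNReal.ofReal (Real.exp (-‖m‖ ^ 2 / (1 + 2 * v)) / (1 + 2 * v)) =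
      ENNReal.ofReal (Real.exp (-m.re ^ 2 / (1 + 2 * v)) / √(1 + 2 * v)) *
      ENNReal.ofReal (Real.exp (-m.im ^ 2 / (1 + 2 * v)) / √(1 + 2 * v)) := by
    rw [← ENNReal.ofReal_mul (by positivity), div_mul_div_comm, ← Real.exp_add,
      Real.mul_self_sqrt hs.le, Complex.sq_norm, Complex.normSq_apply]
    congr 3
    ring
  rw [lintegral_prod _ (by fun_prop), lintegral_prod _ (by fun_prop), hconst]
  have hin : ∀ x : ℝ, Measurable fun y => g (x, y) := fun x => by fun_prop
  have hinner : ∀ x : ℝ, ∫⁻ y, ENNReal.ofReal (Real.exp (-(m.re + x) ^ 2)) *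
      ENNReal.ofReal (Real.exp (-(m.im + y) ^ 2)) * g (x, y) ∂(gaussianReal 0 v) =
      ENNReal.ofReal (Real.exp (-(m.re + x) ^ 2)) *
        (ENNReal.ofReal (Real.exp (-m.im ^ 2 / (1 + 2 * v)) / √(1 + 2 * v)) *
          ∫⁻ y, g (x, y) ∂(gaussianReal (-(2 * v * m.im) / (1 + 2 * v)) (v / (1 + 2 * v)))) := by
    intro x
    simp only [mul_assoc]
    have hin := hin x
    rw [lintegral_const_mul _ (by fun_prop)]
    simpa only [mul_assoc] using
      congrArg (ENNReal.ofReal (Real.exp (-(m.re + x) ^ 2)) * ·)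
        (lintegral_exp_mul_gaussianReal m.im hv hin)
  simp only [hexp, hinner]
  rw [lintegral_exp_mul_gaussianReal m.re hv
    ((Measurable.lintegral_prod_right' hg).const_mul _),
    lintegral_const_mul _ (Measurable.lintegral_prod_right' hg)]
  exact (mul_assoc (ENNReal.ofReal _) (ENNReal.ofReal _) _).symm

theorem lintegral_normSq_add_apply (hξ : IsComplexWhiteNoise P ξ) (c : ℂ) (φ : 𝓢(ℝ, ℂ)) :
    ∫⁻ ω, ENNReal.ofReal (‖c + ξ ω φ‖ ^ 2) ∂P =
      ENNReal.ofReal (‖c‖ ^ 2 + (pairing φ φ).re) := by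
  rw [lintegral_apply hξ φ (g := fun z => ENNReal.ofReal (‖c + z‖ ^ 2)) (by fun_prop)]
  have h := lintegral_normSq_gaussian c 1 0 0 (halfNormSq φ) (halfNormSq φ)
  simp only [one_mul] at h
  rw [h, coe_halfNormSq]
  congr 1
  simp

/-- Gaussian regression: `β' = β - κ • α` is orthogonal to `α`, so `ξ β'` is independent of `ξ α`
and averaging over it only adds its variance. The exponential then tilts the law of `ξ α`, leaving a
second moment. Here `s` is the variance of `ξ α` plus the unit variance of the separated constant
`X`. -/
theorem lintegral_exp_normSq_mul_normSq (hξ : IsComplexWhiteNoise P ξ) (m₀ m₁ κ : ℂ)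
    (α β : 𝓢(ℝ, ℂ)) {s : ℝ} (hs : 1 < s) (hα : pairing α α = s - 1)
    (hβ : pairing β α = κ * pairing α α) :
    ∫⁻ ω, ENNReal.ofReal (Real.pi⁻¹ * Real.exp (-‖m₀ + ξ ω α‖ ^ 2) * ‖m₁ + ξ ω β‖ ^ 2) ∂P =
      ENNReal.ofReal (Real.pi⁻¹ * (Real.exp (-‖m₀‖ ^ 2 / s) / s) *
        (‖m₁ - pairing β α / s * m₀‖ ^ 2 + ((pairing β β).re - ‖pairing β α‖ ^ 2 / s))) := by
  set β' : 𝓢(ℝ, ℂ) := β - κ • α with hβ'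
  have hpair : pairing α β' = 0 := by
    rw [← pairing_conj_symm, hβ', pairing_sub_left, pairing_smul_left, hβ, sub_self, map_zero]
  have hβ'0 : pairing β' β' = pairing β β - κ * (starRingEnd ℂ) κ * (s - 1) := by
    have h1 : pairing β' α = 0 := by rw [← pairing_conj_symm, hpair, map_zero]
    have h2 : pairing α β = (starRingEnd ℂ) κ * (s - 1) := by
      rw [← pairing_conj_symm, hβ, hα]; simp
    conv_lhs => rw [hβ', pairing_sub_right, ← hβ', pairing_smul_right, h1]
    rw [hβ', pairing_sub_left, pairing_smul_left, h2]
    ring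
  have hβ're : (pairing β' β').re = (pairing β β).re - ‖κ‖ ^ 2 * (s - 1) := by
    rw [hβ'0, Complex.mul_conj']
    norm_cast
  have hind : IndepFun (fun ω => ξ ω α) (fun ω => ξ ω β') P :=
    (indepFun_apply hξ (fun _ : Unit => α) (fun _ : Unit => β') fun _ _ => hpair).comp
      (measurable_pi_apply ()) (measurable_pi_apply ())
  have hjoint := (indepFun_iff_map_prod_eq_prod_map_map (hξ.measurable α).aemeasurable
    (hξ.measurable β').aemeasurable).1 hind
  have hpi : (0 : ℝ) ≤ Real.pi⁻¹ := by positivity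
  have hsplit : ∀ ω, ENNReal.ofReal
      (Real.pi⁻¹ * Real.exp (-‖m₀ + ξ ω α‖ ^ 2) * ‖m₁ + ξ ω β‖ ^ 2) =
      ENNReal.ofReal Real.pi⁻¹ * (ENNReal.ofReal (Real.exp (-‖m₀ + ξ ω α‖ ^ 2)) *
        ENNReal.ofReal (‖(m₁ + κ * ξ ω α) + ξ ω β'‖ ^ 2)) := by
    intro ω
    rw [← ENNReal.ofReal_mul (by positivity), ← ENNReal.ofReal_mul hpi, hβ', map_sub, map_smul,
      smul_eq_mul, mul_assoc, add_add_sub_cancel]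
  have hstep : ∫⁻ ω, ENNReal.ofReal (Real.exp (-‖m₀ + ξ ω α‖ ^ 2)) *
        ENNReal.ofReal (‖(m₁ + κ * ξ ω α) + ξ ω β'‖ ^ 2) ∂P =
      ∫⁻ ω, ENNReal.ofReal (Real.exp (-‖m₀ + ξ ω α‖ ^ 2)) *
        ENNReal.ofReal (‖m₁ + κ * ξ ω α‖ ^ 2 + (pairing β' β').re) ∂P := by
    let G : ℂ × ℂ → ENNReal := fun p => ENNReal.ofReal (Real.exp (-‖m₀ + p.1‖ ^ 2)) *
        ENNReal.ofReal (‖(m₁ + κ * p.1) + p.2‖ ^ 2)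
    have hG : Measurable G := by fun_prop
    have h1 : ∫⁻ ω, G (ξ ω α, ξ ω β') ∂P = ∫⁻ p, G p ∂(P.map fun ω => (ξ ω α, ξ ω β')) :=
      (lintegral_map hG ((hξ.measurable α).prodMk (hξ.measurable β'))).symm
    have h2 : ∀ z, ∫⁻ ω, G (z, ξ ω β') ∂P = ENNReal.ofReal (Real.exp (-‖m₀ + z‖ ^ 2)) *
        ENNReal.ofReal (‖m₁ + κ * z‖ ^ 2 + (pairing β' β').re) := by
      intro z
      simp only [G]
      rw [lintegral_const_mul _ (((hξ.measurable β').const_add _).norm.pow_const 2).ennreal_ofReal,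
        lintegral_normSq_add_apply hξ]
    change ∫⁻ ω, G (ξ ω α, ξ ω β') ∂P = _
    rw [h1, hjoint, lintegral_prod _ hG.aemeasurable,
      lintegral_map hG.lintegral_prod_right' (hξ.measurable α)]
    refine lintegral_congr fun ω => ?_
    rw [lintegral_map (by fun_prop) (hξ.measurable β'), h2]
  have hv : (halfNormSq α : ℝ) = (s - 1) / 2 := by
    rw [coe_halfNormSq, hα]
    simp
  have hv0 : halfNormSq α ≠ 0 := by
    intro h0
    rw [h0] at hv
    simp only [NNReal.coe_zero] at hv
    linarith
  have hs' : 1 + 2 * (halfNormSq α : ℝ) = s := by rw [hv]; ring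
  have hs0 : (s : ℂ) ≠ 0 := by exact_mod_cast (by linarith : s ≠ 0)
  have hnn : 0 ≤ (pairing β' β').re := by
    rw [pairing_self, Complex.ofReal_re]; positivity
  simp only [hsplit]
  rw [lintegral_const_mul _ (by
      have := hξ.measurable α
      have := hξ.measurable β'
      fun_prop), hstep,
    lintegral_apply hξ α (g := fun z => ENNReal.ofReal (Real.exp (-‖m₀ + z‖ ^ 2)) *
        ENNReal.ofReal (‖m₁ + κ * z‖ ^ 2 + (pairing β' β').re)) (by fun_prop),
    lintegral_exp_mul_gaussianReal_prod m₀ hv0 (g := fun p =>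
      ENNReal.ofReal (‖m₁ + κ * (p.1 + p.2 * Complex.I)‖ ^ 2 + (pairing β' β').re)) (by fun_prop)]
  simp_rw [ENNReal.ofReal_add (sq_nonneg _) hnn]
  rw [lintegral_add_right _ measurable_const, lintegral_normSq_gaussian, lintegral_const,
    measure_univ, mul_one, ← ENNReal.ofReal_add (by positivity) hnn, hs',
    ← ENNReal.ofReal_mul (by positivity), ← ENNReal.ofReal_mul hpi, mul_assoc Real.pi⁻¹]
  congr 3
  have hmean : ((-(2 * (halfNormSq α : ℝ) * m₀.re) / s : ℝ) : ℂ) +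
      ((-(2 * (halfNormSq α : ℝ) * m₀.im) / s : ℝ) : ℂ) * Complex.I = -((s - 1) / s * m₀) := by
    rw [hv]
    conv_rhs => rw [← Complex.re_add_im m₀]
    push_cast
    field_simp
    ring
  rw [hmean, hβ're, hβ, hα]
  have hnorm : ‖κ * ((s : ℂ) - 1)‖ ^ 2 = ‖κ‖ ^ 2 * (s - 1) ^ 2 := by
    rw [norm_mul, mul_pow]
    congr 1
    rw [← Complex.ofReal_one, ← Complex.ofReal_sub, Complex.norm_real, Real.norm_eq_abs, sq_abs]
  rw [hnorm]
  have harg : m₁ + κ * -(((s : ℂ) - 1) / s * m₀) = m₁ - κ * ((s : ℂ) - 1) / s * m₀ := by ring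
  rw [harg]
  have hsr : s ≠ 0 := by linarith
  push_cast
  rw [hs', hv]
  field_simp
  ring

/-! ### The normalized atoms, indexed holomorphically -/

/-- The Schwartz function `2^{1/4} e^{-π w²/2} e^{-π t² + 2 π w t}`. -/
def bargmannAtom (w : ℂ) : 𝓢(ℝ, ℂ) :=
  ((((2 : ℝ) ^ (1 / 4 : ℝ) : ℝ) : ℂ) * Complex.exp (-Real.pi * w ^ 2 / 2)) •
    gaussSchwartz (2 * Real.pi * w)

/-- The derivative of `bargmannAtom`. -/
def bargmannAtomDeriv (w : ℂ) : 𝓢(ℝ, ℂ) :=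
  ((((2 : ℝ) ^ (1 / 4 : ℝ) : ℝ) : ℂ) * Complex.exp (-Real.pi * w ^ 2 / 2)) •
    ((2 * Real.pi : ℂ) • mulGaussSchwartz (2 * Real.pi * w) -
      (Real.pi * w : ℂ) • gaussSchwartz (2 * Real.pi * w))

theorem bargmannAtom_apply (w : ℂ) (t : ℝ) : bargmannAtom w t =
    (((2 : ℝ) ^ (1 / 4 : ℝ) : ℝ) : ℂ) *
      Complex.exp (-Real.pi * (t : ℂ) ^ 2 + 2 * Real.pi * w * t + -Real.pi * w ^ 2 / 2) := by
  rw [Complex.exp_add _ (-Real.pi * w ^ 2 / 2), bargmannAtom, smul_apply, gaussSchwartz_apply,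
    smul_eq_mul]
  ring

theorem hasDerivAt_apply_bargmannAtom (T : 𝓢'(ℝ, ℂ)) (w : ℂ) :
    HasDerivAt (fun w => T (bargmannAtom w)) (T (bargmannAtomDeriv w)) w := by
  have h1 : HasDerivAt (fun w : ℂ => Complex.exp (-Real.pi * w ^ 2 / 2))
      (Complex.exp (-Real.pi * w ^ 2 / 2) * (-Real.pi * w)) w := by
    refine HasDerivAt.cexp ?_
    refine ((((hasDerivAt_id w).pow 2).const_mul (-Real.pi : ℂ)).div_const 2).congr_deriv ?_
    simp
    ring
  have h2 : HasDerivAt (fun w : ℂ => T (gaussSchwartz (2 * Real.pi * w)))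
      (T (mulGaussSchwartz (2 * Real.pi * w)) * (2 * Real.pi)) w := by
    refine HasDerivAt.comp w (h₂ := fun c => T (gaussSchwartz c))
      (hasDerivAt_apply_gaussSchwartz T _) ?_
    simpa using (hasDerivAt_id w).const_mul (2 * Real.pi : ℂ)
  have h3 := (h1.const_mul (((2 : ℝ) ^ (1 / 4 : ℝ) : ℝ) : ℂ)).mul h2
  simp only [bargmannAtom, bargmannAtomDeriv, map_smul, map_sub, smul_eq_mul]
  refine h3.congr_deriv ?_
  ring

/-- Lets the differentiation of `T (bargmannAtom w)` apply to the covariance kernel, so that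
covariances involving `bargmannAtomDeriv` are derivatives of the kernel. -/
theorem exists_distribution_pairing (ψ : 𝓢(ℝ, ℂ)) :
    ∃ T : 𝓢'(ℝ, ℂ), ∀ φ, T φ = pairing φ ψ := by
  have hm : MemLp (fun t : ℝ => (starRingEnd ℂ) (ψ t)) 2 volume := (ψ.memLp 2 volume).star
  refine ⟨Lp.toTemperedDistribution (hm.toLp _), fun φ => ?_⟩
  rw [Lp.toTemperedDistribution_apply, pairing]
  refine integral_congr_ae ?_
  filter_upwards [hm.coeFn_toLp] with t ht
  rw [ht, smul_eq_mul]

theorem hasDerivAt_pairing_bargmannAtom (w : ℂ) (ψ : 𝓢(ℝ, ℂ)) :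
    HasDerivAt (fun w => pairing (bargmannAtom w) ψ) (pairing (bargmannAtomDeriv w) ψ) w := by
  obtain ⟨T, hT⟩ := exists_distribution_pairing ψ
  simpa only [hT] using hasDerivAt_apply_bargmannAtom T w

theorem two_rpow_quarter_sq : (((2 : ℝ) ^ (1 / 4 : ℝ) : ℝ)) ^ 2 = √2 := by
  rw [← Real.rpow_natCast, ← Real.rpow_mul (by norm_num), Real.sqrt_eq_rpow]
  norm_num

theorem pairing_bargmannAtom (w v : ℂ) : pairing (bargmannAtom w) (bargmannAtom v) =
    Complex.exp (Real.pi * w * (starRingEnd ℂ) v) := by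
  have h : ∀ t : ℝ, bargmannAtom w t * (starRingEnd ℂ) (bargmannAtom v t) = (√2 : ℂ) *
      Complex.exp ((-2 * Real.pi : ℂ) * (t : ℂ) ^ 2 + (2 * Real.pi * (w + (starRingEnd ℂ) v)) * t +
        (-Real.pi * (w ^ 2 + (starRingEnd ℂ) v ^ 2) / 2)) := by
    intro t
    rw [bargmannAtom_apply, bargmannAtom_apply, map_mul, Complex.conj_ofReal, ← Complex.exp_conj,
      mul_mul_mul_comm, ← Complex.exp_add, ← pow_two, ← Complex.ofReal_pow, two_rpow_quarter_sq]
    congr 2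
    simp only [map_add, map_mul, map_div₀, map_pow, map_neg, Complex.conj_ofReal, map_ofNat]
    ring
  have hpi : (Real.pi : ℂ) ≠ 0 := by exact_mod_cast Real.pi_ne_zero
  rw [pairing]
  simp only [h]
  rw [integral_const_mul, integral_cexp_quadratic (by simp [Real.pi_pos])]
  have h1 : (Real.pi / -(-2 * Real.pi) : ℂ) = ((1 / 2 : ℝ) : ℂ) := by
    push_cast
    field_simp
  have h2 : (((1 / 2 : ℝ) : ℂ)) ^ (1 / 2 : ℂ) = ((√(1 / 2) : ℝ) : ℂ) := by
    rw [Real.sqrt_eq_rpow, Complex.ofReal_cpow (by norm_num)]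
    push_cast
    rfl
  rw [h1, h2, ← mul_assoc, ← Complex.ofReal_mul, ← Real.sqrt_mul (by norm_num)]
  norm_num
  congr 1
  field_simp
  ring

theorem pairing_bargmannAtomDeriv_bargmannAtom (w v : ℂ) :
    pairing (bargmannAtomDeriv w) (bargmannAtom v) =
      Real.pi * (starRingEnd ℂ) v * Complex.exp (Real.pi * w * (starRingEnd ℂ) v) := by
  have h1 := hasDerivAt_pairing_bargmannAtom w (bargmannAtom v)
  simp only [pairing_bargmannAtom] at h1
  refine h1.unique ?_
  refine (HasDerivAt.cexp (((hasDerivAt_id w).const_mul (Real.pi : ℂ)).mul_const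
    ((starRingEnd ℂ) v))).congr_deriv ?_
  simp
  ring

/-- Conjugate symmetry puts the derivative in the second slot; differentiating the resulting kernel
in `w` then supplies the other one. -/
theorem pairing_bargmannAtomDeriv (w v : ℂ) :
    pairing (bargmannAtomDeriv w) (bargmannAtomDeriv v) =
      (Real.pi + Real.pi ^ 2 * w * (starRingEnd ℂ) v) *
        Complex.exp (Real.pi * w * (starRingEnd ℂ) v) := by
  have h1 := hasDerivAt_pairing_bargmannAtom w (bargmannAtomDeriv v)
  have h2 : ∀ w, pairing (bargmannAtom w) (bargmannAtomDeriv v) =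
      Real.pi * w * Complex.exp (Real.pi * w * (starRingEnd ℂ) v) := by
    intro w
    rw [← pairing_conj_symm, pairing_bargmannAtomDeriv_bargmannAtom, map_mul, map_mul,
      ← Complex.exp_conj]
    simp only [map_mul, Complex.conj_ofReal, Complex.conj_conj]
    ring_nf
  simp only [h2] at h1
  refine h1.unique ?_
  have h3 := (hasDerivAt_id w).const_mul (Real.pi : ℂ)
  refine (h3.mul (HasDerivAt.cexp (h3.mul_const ((starRingEnd ℂ) v)))).congr_deriv ?_
  simp
  ring

/-! ### Comparison with the short-time Fourier transform -/

/-- The nonvanishing factor between `atom z` and `bargmannAtom (conj z)`. -/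
def atomFactor (z : ℂ) : ℂ :=
  Complex.exp (-Real.pi * (z.re : ℂ) ^ 2 + Real.pi * (starRingEnd ℂ) z ^ 2 / 2)

theorem norm_atomFactor_sq (z : ℂ) : ‖atomFactor z‖ ^ 2 = (Real.exp (Real.pi * ‖z‖ ^ 2))⁻¹ := by
  have h : (-Real.pi * (z.re : ℂ) ^ 2 + Real.pi * (starRingEnd ℂ) z ^ 2 / 2).re =
      -(Real.pi * ‖z‖ ^ 2) / 2 := by
    rw [Complex.sq_norm, Complex.normSq_apply]
    have : -Real.pi * (z.re : ℂ) ^ 2 + Real.pi * (starRingEnd ℂ) z ^ 2 / 2 =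
        ((-Real.pi * z.re ^ 2 : ℝ) : ℂ) + ((Real.pi / 2 : ℝ) : ℂ) * (starRingEnd ℂ) z ^ 2 := by
      push_cast; ring
    rw [this, Complex.add_re, Complex.re_ofReal_mul, Complex.ofReal_re, pow_two ((starRingEnd ℂ) z),
      Complex.mul_re, Complex.conj_re, Complex.conj_im]
    ring
  rw [atomFactor, Complex.norm_exp, h, ← Real.exp_nat_mul, ← Real.exp_neg]
  congr 1
  push_cast
  ring

theorem atom_eq (z : ℂ) : atom z = atomFactor z • bargmannAtom ((starRingEnd ℂ) z) := by
  ext t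
  change atomFun z t = atomFactor z • bargmannAtom ((starRingEnd ℂ) z) t
  have hz : (starRingEnd ℂ) z = z.re - z.im * Complex.I := by
    apply Complex.ext <;> simp
  rw [bargmannAtom_apply, atomFun, gaussWindow, atomFactor, smul_eq_mul, Complex.ofReal_mul,
    Complex.ofReal_exp, mul_assoc, ← Complex.exp_add, mul_left_comm, ← Complex.exp_add]
  congr 2
  rw [hz]
  push_cast
  ring

/-- The deterministic analogue of pairing with `bargmannAtom`. -/
def bargmannTransform (x : ℝ → ℂ) (w : ℂ) : ℂ := ∫ t : ℝ, x t * bargmannAtom w t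

theorem stft_eq (x : ℝ → ℂ) (z : ℂ) :
    stft x z = atomFactor z * bargmannTransform x ((starRingEnd ℂ) z) := by
  rw [stft, bargmannTransform, ← integral_const_mul]
  refine integral_congr_ae (.of_forall fun t => ?_)
  have h : atomFun z t = atomFactor z * bargmannAtom ((starRingEnd ℂ) z) t :=
    congrArg (fun φ : 𝓢(ℝ, ℂ) => φ t) (atom_eq z)
  simp only [h]
  ring

theorem spectrogram_eq (x : ℝ → ℂ) (z : ℂ) : spectrogram x z =
    ‖bargmannTransform x ((starRingEnd ℂ) z)‖ ^ 2 / Real.exp (Real.pi * ‖z‖ ^ 2) := by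
  rw [spectrogram, stft_eq, norm_mul, mul_pow, norm_atomFactor_sq]
  ring

theorem noisySpectrogram_eq_zero_iff (x : ℝ → ℂ) (T : 𝓢'(ℝ, ℂ)) (z : ℂ) :
    noisySpectrogram x T z = 0 ↔
      bargmannTransform x ((starRingEnd ℂ) z) + T (bargmannAtom ((starRingEnd ℂ) z)) = 0 := by
  rw [noisySpectrogram, stft_eq, atom_eq, map_smul, smul_eq_mul, ← mul_add]
  simp [atomFactor, Complex.exp_ne_zero]

/-! ### The transform of the pair of chirps -/

/-- The exponent of the transform of a chirp. -/
def chirpExponent (a b : ℝ) (w : ℂ) : ℂ :=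
  -Real.pi * w ^ 2 / 2 + Real.pi * (w + Complex.I * a) ^ 2 / (1 - 2 * Complex.I * b)

/-- The constant factor of the transform of a chirp. -/
def chirpConst (b : ℝ) : ℂ :=
  (((2 : ℝ) ^ (1 / 4 : ℝ) : ℝ) : ℂ) * (1 / (1 - 2 * Complex.I * b)) ^ (1 / 2 : ℂ)

theorem one_sub_ne_zero (b : ℝ) : (1 - 2 * Complex.I * b : ℂ) ≠ 0 := by
  intro h
  have := congrArg Complex.re h
  simp at this

theorem normSq_one_sub (b : ℝ) : ‖(1 - 2 * Complex.I * b : ℂ)‖ ^ 2 = 1 + 4 * b ^ 2 := by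
  rw [Complex.sq_norm, Complex.normSq_apply]
  simp
  ring

theorem sigma_eq (b : ℝ) : sigma b = √2 / √(1 + 4 * b ^ 2) := by
  rw [sigma, Real.sqrt_div (by norm_num)]

theorem sigma_div (b : ℝ) : sigma b / √2 = (√(1 + 4 * b ^ 2))⁻¹ := by
  rw [sigma_eq]
  field_simp

theorem norm_chirpConst_sq (b : ℝ) : ‖chirpConst b‖ ^ 2 = sigma b := by
  have h1 : ‖(1 / (1 - 2 * Complex.I * b) : ℂ) ^ (1 / 2 : ℂ)‖ ^ 2 = (√(1 + 4 * b ^ 2))⁻¹ := by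
    rw [← norm_pow, one_div (2 : ℂ)]
    have := Complex.cpow_nat_inv_pow (1 / (1 - 2 * Complex.I * b) : ℂ) (n := 2) two_ne_zero
    push_cast at this
    rw [this, norm_div, norm_one, one_div, ← normSq_one_sub, Real.sqrt_sq (norm_nonneg _)]
  rw [chirpConst, norm_mul, mul_pow, h1, Complex.norm_real, Real.norm_of_nonneg (by positivity),
    two_rpow_quarter_sq, sigma_eq]
  ring

theorem chirp_quadratic (a b : ℝ) (w : ℂ) (t : ℝ) :
    Complex.exp (2 * Complex.I * Real.pi * t * (a + b * t)) * bargmannAtom w t =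
      (((2 : ℝ) ^ (1 / 4 : ℝ) : ℝ) : ℂ) *
        Complex.exp ((-Real.pi * (1 - 2 * Complex.I * b)) * (t : ℂ) ^ 2 +
          (2 * Real.pi * (w + Complex.I * a)) * t + -Real.pi * w ^ 2 / 2) := by
  rw [bargmannAtom_apply, mul_left_comm, ← Complex.exp_add]
  congr 2
  ring

theorem re_quadratic_neg (b : ℝ) : (-Real.pi * (1 - 2 * Complex.I * b) : ℂ).re < 0 := by
  simp [Real.pi_pos]

theorem integrable_chirp_mul (a b : ℝ) (w : ℂ) : Integrable fun t : ℝ =>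
    Complex.exp (2 * Complex.I * Real.pi * t * (a + b * t)) * bargmannAtom w t := by
  simp only [chirp_quadratic]
  exact (integrable_cexp_quadratic' (re_quadratic_neg b) _ _).const_mul _

theorem bargmannTransform_chirp (a b : ℝ) (w : ℂ) :
    bargmannTransform (fun t : ℝ => Complex.exp (2 * Complex.I * Real.pi * t * (a + b * t))) w =
      chirpConst b * Complex.exp (chirpExponent a b w) := by
  have hpi : (Real.pi : ℂ) ≠ 0 := by exact_mod_cast Real.pi_ne_zero
  have hq := one_sub_ne_zero b
  rw [bargmannTransform]
  simp only [chirp_quadratic]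
  rw [integral_const_mul, integral_cexp_quadratic (re_quadratic_neg b), chirpConst, chirpExponent]
  generalize (1 - 2 * Complex.I * b : ℂ) = q at hq
  have h1 : (Real.pi : ℂ) / -(-Real.pi * q) = 1 / q := by field_simp
  have h2 : -Real.pi * w ^ 2 / 2 - (2 * Real.pi * (w + Complex.I * a)) ^ 2 / (4 * (-Real.pi * q)) =
      -Real.pi * w ^ 2 / 2 + Real.pi * (w + Complex.I * a) ^ 2 / q := by
    field_simp
    ring
  rw [h1, h2]
  ring

theorem bargmannTransform_chirpPair (γ₁ γ₂ a₁ a₂ b : ℝ) (w : ℂ) :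
    bargmannTransform (chirpPair γ₁ γ₂ a₁ a₂ b) w =
      √γ₁ * (chirpConst b * Complex.exp (chirpExponent a₁ b w)) +
        √γ₂ * (chirpConst b * Complex.exp (chirpExponent a₂ b w)) := by
  rw [← bargmannTransform_chirp, ← bargmannTransform_chirp, bargmannTransform, bargmannTransform,
    bargmannTransform, ← integral_const_mul, ← integral_const_mul, ← integral_add]
  · refine integral_congr_ae (.of_forall fun t => ?_)
    simp only [chirpPair]
    ring
  · exact (integrable_chirp_mul a₁ b w).const_mul _
  · exact (integrable_chirp_mul a₂ b w).const_mul _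

theorem hasDerivAt_chirp (a b : ℝ) (w : ℂ) :
    HasDerivAt (fun w => chirpConst b * Complex.exp (chirpExponent a b w))
      ((-Real.pi * w + 2 * Real.pi * (w + Complex.I * a) / (1 - 2 * Complex.I * b)) *
        (chirpConst b * Complex.exp (chirpExponent a b w))) w := by
  have h1 := (((hasDerivAt_id w).pow 2).const_mul (-Real.pi : ℂ)).div_const 2
  have h2 := ((((hasDerivAt_id w).add_const (Complex.I * a)).pow 2).const_mul
    (Real.pi : ℂ)).div_const (1 - 2 * Complex.I * b)
  have h3 : HasDerivAt (chirpExponent a b)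
      (-Real.pi * w + 2 * Real.pi * (w + Complex.I * a) / (1 - 2 * Complex.I * b)) w := by
    refine (h1.add h2).congr_deriv ?_
    simp
    ring
  refine (h3.cexp.const_mul (chirpConst b)).congr_deriv ?_
  ring

/-- The derivative of the transform of the pair of chirps. -/
def chirpPairDeriv (γ₁ γ₂ a₁ a₂ b : ℝ) (w : ℂ) : ℂ :=
  √γ₁ * ((-Real.pi * w + 2 * Real.pi * (w + Complex.I * a₁) / (1 - 2 * Complex.I * b)) *
      (chirpConst b * Complex.exp (chirpExponent a₁ b w))) +
    √γ₂ * ((-Real.pi * w + 2 * Real.pi * (w + Complex.I * a₂) / (1 - 2 * Complex.I * b)) *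
      (chirpConst b * Complex.exp (chirpExponent a₂ b w)))

theorem hasDerivAt_bargmannTransform_chirpPair (γ₁ γ₂ a₁ a₂ b : ℝ) (w : ℂ) :
    HasDerivAt (bargmannTransform (chirpPair γ₁ γ₂ a₁ a₂ b)) (chirpPairDeriv γ₁ γ₂ a₁ a₂ b w) w := by
  have h : bargmannTransform (chirpPair γ₁ γ₂ a₁ a₂ b) = fun w =>
      √γ₁ * (chirpConst b * Complex.exp (chirpExponent a₁ b w)) +
        √γ₂ * (chirpConst b * Complex.exp (chirpExponent a₂ b w)) :=
    funext (bargmannTransform_chirpPair γ₁ γ₂ a₁ a₂ b)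
  rw [h]
  exact ((hasDerivAt_chirp a₁ b w).const_mul _).add ((hasDerivAt_chirp a₂ b w).const_mul _)

/-- Splits modulus from phase: the term `π ‖z‖² / 2` is cancelled by `atomFactor`, and what remains
of the modulus is a Gaussian in the distance to the chirp's axis. -/
theorem chirpExponent_conj_eq (a b : ℝ) (z : ℂ) : chirpExponent a b ((starRingEnd ℂ) z) =
    ((Real.pi * ‖z‖ ^ 2 / 2 - Real.pi * (rCoord a b z) ^ 2 : ℝ) : ℂ) +
      ((Real.pi * (z.re * z.im) + 2 * Real.pi * (b * (z.re ^ 2 - (z.im - a) ^ 2) -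
        z.re * (z.im - a)) / (1 + 4 * b ^ 2) : ℝ) : ℂ) * Complex.I := by
  have hq := one_sub_ne_zero b
  have hs : (0 : ℝ) < 1 + 4 * b ^ 2 := by positivity
  have hinv : (1 - 2 * Complex.I * b : ℂ)⁻¹ = (1 + 2 * Complex.I * b) / ((1 + 4 * b ^ 2 : ℝ) : ℂ) := by
    have : ((1 + 4 * b ^ 2 : ℝ) : ℂ) ≠ 0 := by exact_mod_cast hs.ne'
    rw [eq_div_iff this, inv_mul_eq_iff_eq_mul₀ hq]
    push_cast
    linear_combination (4 * (b : ℂ) ^ 2) * Complex.I_sq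
  have hr : (rCoord a b z) ^ 2 = (z.im - 2 * b * z.re - a) ^ 2 / (1 + 4 * b ^ 2) := by
    rw [rCoord, sigma_div, mul_pow, inv_pow, Real.sq_sqrt hs.le]
    ring
  have hz : (starRingEnd ℂ) z = z.re - z.im * Complex.I := by apply Complex.ext <;> simp
  have hsc : (1 + 4 * b ^ 2 : ℂ) ≠ 0 := by exact_mod_cast hs.ne'
  rw [chirpExponent, div_eq_mul_inv _ (1 - 2 * Complex.I * b : ℂ), hinv, hr, Complex.sq_norm,
    Complex.normSq_apply, hz]
  push_cast
  simp only [div_eq_mul_inv]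
  have hi := mul_inv_cancel₀ hsc
  generalize (1 + 4 * b ^ 2 : ℂ)⁻¹ = i at hi
  ring_nf
  simp only [Complex.I_sq, show Complex.I ^ 3 = -Complex.I by rw [pow_succ, Complex.I_sq]; ring]
  linear_combination (Real.pi * z.re ^ 2 : ℂ) * hi

/-- Modulus of a real combination of the transforms of the two chirps. -/
theorem normSq_combination (γ₁ γ₂ a₁ a₂ b p₁ p₂ : ℝ) (hγ₁ : 0 ≤ γ₁) (hγ₂ : 0 ≤ γ₂) (z : ℂ) :
    ‖(p₁ : ℂ) * (√γ₁ * (chirpConst b *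
        Complex.exp (chirpExponent a₁ b ((starRingEnd ℂ) z)))) +
      p₂ * (√γ₂ * (chirpConst b * Complex.exp (chirpExponent a₂ b ((starRingEnd ℂ) z))))‖ ^ 2 /
      Real.exp (Real.pi * ‖z‖ ^ 2) =
    sigma b * (γ₁ * p₁ ^ 2 * Real.exp (-2 * Real.pi * rCoord a₁ b z ^ 2) +
      γ₂ * p₂ ^ 2 * Real.exp (-2 * Real.pi * (rCoord a₁ b z - axisDist a₁ a₂ b) ^ 2) +
      2 * √(γ₁ * γ₂) * p₁ * p₂ * Real.exp (-Real.pi * rCoord a₁ b z ^ 2 -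
        Real.pi * (rCoord a₁ b z - axisDist a₁ a₂ b) ^ 2) *
        Real.cos (2 * Real.pi * axisDist a₁ a₂ b * sCoord a₁ a₂ b z)) := by
  have hs : (0 : ℝ) < 1 + 4 * b ^ 2 := by positivity
  have hr : rCoord a₁ b z - axisDist a₁ a₂ b = rCoord a₂ b z := by
    simp only [rCoord, axisDist]; ring
  rw [hr]
  set r₁ := rCoord a₁ b z
  set r₂ := rCoord a₂ b z
  rw [chirpExponent_conj_eq, chirpExponent_conj_eq]
  set θ₁ : ℝ := Real.pi * (z.re * z.im) + 2 * Real.pi * (b * (z.re ^ 2 - (z.im - a₁) ^ 2) -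
        z.re * (z.im - a₁)) / (1 + 4 * b ^ 2) with hθ₁
  set θ₂ : ℝ := Real.pi * (z.re * z.im) + 2 * Real.pi * (b * (z.re ^ 2 - (z.im - a₂) ^ 2) -
        z.re * (z.im - a₂)) / (1 + 4 * b ^ 2) with hθ₂
  -- The interference term is governed by the phase difference; the shift `(a₁ + a₂) b` in `sCoord`
  -- is what makes it exactly proportional to `s`.
  have hθ : 2 * Real.pi * axisDist a₁ a₂ b * sCoord a₁ a₂ b z = θ₂ - θ₁ := by
    rw [axisDist, sCoord, sigma_div, hθ₁, hθ₂]
    have : (√(1 + 4 * b ^ 2))⁻¹ * (√(1 + 4 * b ^ 2))⁻¹ = (1 + 4 * b ^ 2)⁻¹ := by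
      rw [← mul_inv, Real.mul_self_sqrt hs.le]
    calc _ = 2 * Real.pi * (a₂ - a₁) * (z.re + 2 * b * z.im - (a₁ + a₂) * b) *
          ((√(1 + 4 * b ^ 2))⁻¹ * (√(1 + 4 * b ^ 2))⁻¹) := by ring
      _ = _ := by
        rw [this]
        field_simp
        ring
  rw [hθ]
  set A₁ : ℝ := p₁ * √γ₁ * Real.exp (-Real.pi * r₁ ^ 2) with hA₁
  set A₂ : ℝ := p₂ * √γ₂ * Real.exp (-Real.pi * r₂ ^ 2) with hA₂
  have hfac : ∀ (p γ r θ : ℝ), (p : ℂ) * (√γ * (chirpConst b *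
      Complex.exp (((Real.pi * ‖z‖ ^ 2 / 2 - Real.pi * r ^ 2 : ℝ) : ℂ) + (θ : ℂ) * Complex.I))) =
      chirpConst b * ((Real.exp (Real.pi * ‖z‖ ^ 2 / 2) : ℝ) : ℂ) *
        (((p * √γ * Real.exp (-Real.pi * r ^ 2) : ℝ) : ℂ) * Complex.exp (θ * Complex.I)) := by
    intro p γ r θ
    rw [Complex.exp_add, sub_eq_add_neg, Complex.ofReal_add, Complex.exp_add,
      ← neg_mul]
    push_cast
    ring
  rw [hfac, hfac, ← mul_add, norm_mul, mul_pow, norm_mul, mul_pow, norm_chirpConst_sq,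
    Complex.norm_real, Real.norm_of_nonneg (Real.exp_pos _).le, ← Real.exp_nat_mul]
  have hnorm : ‖(A₁ : ℂ) * Complex.exp (θ₁ * Complex.I) + A₂ * Complex.exp (θ₂ * Complex.I)‖ ^ 2 =
      A₁ ^ 2 + A₂ ^ 2 + 2 * A₁ * A₂ * Real.cos (θ₂ - θ₁) := by
    rw [Complex.sq_norm, Complex.normSq_apply, Real.cos_sub]
    simp only [Complex.add_re, Complex.add_im, Complex.re_ofReal_mul, Complex.im_ofReal_mul,
      Complex.exp_ofReal_mul_I_re, Complex.exp_ofReal_mul_I_im]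
    linear_combination A₁ ^ 2 * Real.sin_sq_add_cos_sq θ₁ + A₂ ^ 2 * Real.sin_sq_add_cos_sq θ₂
  have hE : Real.exp (((2 : ℕ) : ℝ) * (Real.pi * ‖z‖ ^ 2 / 2)) = Real.exp (Real.pi * ‖z‖ ^ 2) := by
    congr 1
    push_cast
    ring
  rw [hnorm, hE, mul_right_comm, mul_div_assoc, div_self (Real.exp_pos _).ne', mul_one]
  congr 1
  have hsq : ∀ r : ℝ, Real.exp (-Real.pi * r ^ 2) ^ 2 = Real.exp (-2 * Real.pi * r ^ 2) := by
    intro r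
    rw [← Real.exp_nat_mul]
    congr 1
    push_cast
    ring
  rw [hA₁, hA₂, mul_pow, mul_pow, mul_pow, mul_pow, hsq, hsq, Real.sq_sqrt hγ₁, Real.sq_sqrt hγ₂,
    Real.sqrt_mul hγ₁, sub_eq_add_neg (-Real.pi * r₁ ^ 2), ← neg_mul, Real.exp_add]
  ring

theorem spectrogram_chirpPair {γ₁ γ₂ : ℝ} (a₁ a₂ b : ℝ) (hγ₁ : 0 ≤ γ₁) (hγ₂ : 0 ≤ γ₂) (z : ℂ) :
    spectrogram (chirpPair γ₁ γ₂ a₁ a₂ b) z =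
      specRS γ₁ γ₂ a₁ a₂ b (rCoord a₁ b z) (sCoord a₁ a₂ b z) := by
  have h := normSq_combination γ₁ γ₂ a₁ a₂ b 1 1 hγ₁ hγ₂ z
  rw [spectrogram_eq, bargmannTransform_chirpPair, specRS]
  simpa using h

/-- At `w = conj z`, the logarithmic derivative of each chirp transform minus `π z` is a multiple of
that chirp's own `rCoord`, with a factor common to both chirps. -/
theorem chirpPairDeriv_sub {γ₁ γ₂ : ℝ} (a₁ a₂ b : ℝ) (z : ℂ) :
    chirpPairDeriv γ₁ γ₂ a₁ a₂ b ((starRingEnd ℂ) z) -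
      Real.pi * z * bargmannTransform (chirpPair γ₁ γ₂ a₁ a₂ b) ((starRingEnd ℂ) z) =
    -(2 * Real.pi * Complex.I * (√(1 + 4 * b ^ 2) : ℝ) / (1 - 2 * Complex.I * b)) *
      ((rCoord a₁ b z : ℂ) * (√γ₁ * (chirpConst b *
        Complex.exp (chirpExponent a₁ b ((starRingEnd ℂ) z)))) +
      ((rCoord a₁ b z - axisDist a₁ a₂ b : ℝ) : ℂ) * (√γ₂ * (chirpConst b *
        Complex.exp (chirpExponent a₂ b ((starRingEnd ℂ) z))))) := by
  have hs : (0 : ℝ) < 1 + 4 * b ^ 2 := by positivity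
  have hr : rCoord a₁ b z - axisDist a₁ a₂ b = rCoord a₂ b z := by
    simp only [rCoord, axisDist]; ring
  have hq := one_sub_ne_zero b
  have hz : (starRingEnd ℂ) z = z.re - z.im * Complex.I := by apply Complex.ext <;> simp
  have key : ∀ a : ℝ, -Real.pi * (starRingEnd ℂ) z + 2 * Real.pi * ((starRingEnd ℂ) z +
      Complex.I * a) / (1 - 2 * Complex.I * b) - Real.pi * z =
      -(2 * Real.pi * Complex.I * (√(1 + 4 * b ^ 2) : ℝ) / (1 - 2 * Complex.I * b)) *
        (rCoord a b z : ℂ) := by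
    intro a
    have h1 : ((√(1 + 4 * b ^ 2) : ℝ) : ℂ) * (rCoord a b z : ℂ) = z.im - 2 * b * z.re - a := by
      rw [rCoord, sigma_div, ← Complex.ofReal_mul, ← mul_assoc,
        mul_inv_cancel₀ (Real.sqrt_pos.2 hs).ne', one_mul]
      push_cast
      ring
    have h2 : -(2 * Real.pi * Complex.I * (√(1 + 4 * b ^ 2) : ℝ) / (1 - 2 * Complex.I * b)) *
        (rCoord a b z : ℂ) = -(2 * Real.pi * Complex.I / (1 - 2 * Complex.I * b)) *
          (((√(1 + 4 * b ^ 2) : ℝ) : ℂ) * (rCoord a b z : ℂ)) := by ring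
    have hz' : z = z.re + z.im * Complex.I := (Complex.re_add_im z).symm
    rw [h2, h1]
    simp only [div_eq_mul_inv]
    have hi := mul_inv_cancel₀ hq
    generalize (1 - 2 * Complex.I * b : ℂ)⁻¹ = i at hi
    linear_combination (2 * Real.pi * z.re : ℂ) * hi - Real.pi * hz - Real.pi * hz' +
      2 * Real.pi * i * hz
  rw [bargmannTransform_chirpPair, chirpPairDeriv, hr]
  linear_combination √γ₁ * (chirpConst b *
        Complex.exp (chirpExponent a₁ b ((starRingEnd ℂ) z))) * key a₁ + √γ₂ * (chirpConst b *
        Complex.exp (chirpExponent a₂ b ((starRingEnd ℂ) z))) * key a₂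

/-- The common factor has squared modulus `4π²`; dividing by `π` leaves the `4π` of `rhoRS`. The
weights `r` and `r - a` enter `normSq_combination` as `p₁` and `p₂`. -/
theorem normSq_chirpPairDeriv_sub {γ₁ γ₂ : ℝ} (a₁ a₂ b : ℝ) (hγ₁ : 0 ≤ γ₁) (hγ₂ : 0 ≤ γ₂)
    (z : ℂ) :
    Real.exp (-specRS γ₁ γ₂ a₁ a₂ b (rCoord a₁ b z) (sCoord a₁ a₂ b z)) *
      (1 + ‖chirpPairDeriv γ₁ γ₂ a₁ a₂ b ((starRingEnd ℂ) z) -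
      Real.pi * z * bargmannTransform (chirpPair γ₁ γ₂ a₁ a₂ b) ((starRingEnd ℂ) z)‖ ^ 2 /
      Real.exp (Real.pi * ‖z‖ ^ 2) / Real.pi) =
    rhoRS γ₁ γ₂ a₁ a₂ b (rCoord a₁ b z) (sCoord a₁ a₂ b z) := by
  have h := normSq_combination γ₁ γ₂ a₁ a₂ b (rCoord a₁ b z)
    (rCoord a₁ b z - axisDist a₁ a₂ b) hγ₁ hγ₂ z
  have hs : (0 : ℝ) < 1 + 4 * b ^ 2 := by positivity
  have hc : ‖-(2 * Real.pi * Complex.I * (√(1 + 4 * b ^ 2) : ℝ) / (1 - 2 * Complex.I * b))‖ ^ 2 =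
      4 * Real.pi ^ 2 := by
    rw [norm_neg, norm_div, div_pow, normSq_one_sub, norm_mul, norm_mul, norm_mul, mul_pow, mul_pow,
      mul_pow, Complex.norm_real, Complex.norm_real, Complex.norm_I, Real.norm_eq_abs, Real.norm_eq_abs,
      sq_abs, sq_abs, Real.sq_sqrt hs.le]
    simp
    field_simp
    norm_num
  rw [chirpPairDeriv_sub, norm_mul, mul_pow, hc, mul_div_assoc, h, rhoRS]
  congr 1
  have := Real.pi_ne_zero
  field_simp

/-! ### From open sets to Borel sets -/

/-- A counting measure whose expectation has density `ρ` on open subsets of `U` has expectation with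
density `ρ` on Borel subsets of `U`. -/
theorem expected_count_of_isOpen {Ω : Type*} [MeasurableSpace Ω] {P : Measure Ω}
    {Z : Ω → Set ℂ} (hZ : ∀ ω, MeasurableSet (Z ω)) {ρ : ℂ → ENNReal}
    {U : Set ℂ} (hU : IsOpen U) (hfin : ∫⁻ z in U, ρ z ≠ ⊤)
    (h : ∀ A, IsOpen A → A ⊆ U → Measurable (fun ω => Measure.count (A ∩ Z ω)) ∧
      ∫⁻ ω, Measure.count (A ∩ Z ω) ∂P = ∫⁻ z in A, ρ z) {A : Set ℂ} (hA : MeasurableSet A) :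
    AEMeasurable (fun ω => Measure.count (A ∩ U ∩ Z ω)) P ∧
      ∫⁻ ω, Measure.count (A ∩ U ∩ Z ω) ∂P = ∫⁻ z in A ∩ U, ρ z := by
  -- Complements require subtracting counts, legitimate only where they are finite. This holds
  -- almost surely, so only a.e. measurability survives.
  have hUfin : ∀ᵐ ω ∂P, Measure.count (U ∩ Z ω) < ⊤ := by
    have hU' := h U hU subset_rfl
    exact ae_lt_top hU'.1 (hU'.2 ▸ hfin)
  induction A, hA using MeasurableSpace.induction_on_inter
    (BorelSpace.measurable_eq (α := ℂ)) isPiSystem_isOpen with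
  | empty => simp
  | basic A hA =>
    have := h (A ∩ U) (IsOpen.inter (Set.mem_ofPred.1 hA) hU) Set.inter_subset_right
    exact ⟨this.1.aemeasurable, this.2⟩
  | compl A hA ih =>
    have hsub : ∀ ω, A ∩ U ∩ Z ω ⊆ U ∩ Z ω := fun ω =>
      Set.inter_subset_inter_left _ Set.inter_subset_right
    have heq : ∀ ω, Aᶜ ∩ U ∩ Z ω = (U ∩ Z ω) \ (A ∩ U ∩ Z ω) := by
      intro ω; ext z; simp only [Set.mem_inter_iff, Set.mem_compl_iff, Set.mem_sdiff]; tauto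
    have hmeas : ∀ ω, MeasurableSet (A ∩ U ∩ Z ω) := fun ω =>
      (hA.inter hU.measurableSet).inter (hZ ω)
    have hae : (fun ω => Measure.count (Aᶜ ∩ U ∩ Z ω)) =ᵐ[P]
        fun ω => Measure.count (U ∩ Z ω) - Measure.count (A ∩ U ∩ Z ω) := by
      filter_upwards [hUfin] with ω hω
      rw [heq, measure_sdiff (hsub ω) (hmeas ω).nullMeasurableSet
        ((measure_mono (hsub ω)).trans_lt hω).ne]
    have hU' := h U hU subset_rfl
    have hle : ∫⁻ z in A ∩ U, ρ z ≤ ∫⁻ z in U, ρ z := lintegral_mono_set Set.inter_subset_right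
    have hfin' : ∫⁻ z in A ∩ U, ρ z ≠ ⊤ := (hle.trans_lt hfin.lt_top).ne
    refine ⟨(hU'.1.aemeasurable.sub ih.1).congr hae.symm, ?_⟩
    rw [lintegral_congr_ae hae, lintegral_sub' ih.1 (ih.2 ▸ hfin')
      (.of_forall fun ω => measure_mono (hsub ω)), ih.2, hU'.2]
    refine ENNReal.sub_eq_of_eq_add hfin' ?_
    rw [add_comm, Set.inter_comm A U, Set.inter_comm Aᶜ U, ← Set.sdiff_eq,
      lintegral_inter_add_sdiff _ _ hA]
  | iUnion A hd hA ih =>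
    have heq : ∀ ω, Measure.count ((⋃ n, A n) ∩ U ∩ Z ω) =
        ∑' n, Measure.count (A n ∩ U ∩ Z ω) := by
      intro ω
      rw [Set.iUnion_inter, Set.iUnion_inter, measure_iUnion
        (fun i j hij => (hd hij).mono (Set.inter_subset_left.trans Set.inter_subset_left)
          (Set.inter_subset_left.trans Set.inter_subset_left))
        (fun n => ((hA n).inter hU.measurableSet).inter (hZ ω))]
    simp only [heq]
    refine ⟨AEMeasurable.tsum fun n => (ih n).1, ?_⟩
    rw [lintegral_tsum fun n => (ih n).1, Set.iUnion_inter, lintegral_iUnion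
      (fun n => (hA n).inter hU.measurableSet)
      (fun i j hij => (hd hij).mono Set.inter_subset_left Set.inter_subset_left)]
    exact tsum_congr fun n => (ih n).2

/-- Intensity functions are unique up to null sets. -/
theorem IsZeroIntensity.ae_eq {Ω : Type*} [MeasurableSpace Ω] {P : Measure Ω} {S : Ω → ℂ → ℝ}
    {ρ ρ' : ℂ → ℝ} (h : IsZeroIntensity P S ρ) (h' : IsZeroIntensity P S ρ') :
    ρ =ᵐ[volume] ρ' := by
  -- Intensities are tested on bounded sets only, hence the exhaustion by balls.
  have hball : ∀ n : ℕ, ∀ᵐ z ∂(volume.restrict (Metric.ball (0 : ℂ) n)),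
      ENNReal.ofReal (ρ z) = ENNReal.ofReal (ρ' z) := by
    intro n
    refine ae_eq_of_forall_setLIntegral_eq_of_sigmaFinite h.measurable.ennreal_ofReal
      h'.measurable.ennreal_ofReal fun A hA _ => ?_
    rw [Measure.restrict_restrict hA, ← h.expected_count, h'.expected_count]
    all_goals first
      | exact hA.inter Metric.isOpen_ball.measurableSet
      | exact Metric.isBounded_ball.subset Set.inter_subset_right
  have hall : ∀ᵐ z, ∀ n : ℕ, z ∈ Metric.ball (0 : ℂ) n →
      ENNReal.ofReal (ρ z) = ENNReal.ofReal (ρ' z) :=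
    ae_all_iff.2 fun n => (ae_restrict_iff' Metric.isOpen_ball.measurableSet).1 (hball n)
  filter_upwards [hall] with z hz
  obtain ⟨n, hn⟩ := exists_nat_gt ‖z‖
  exact (ENNReal.ofReal_eq_ofReal_iff (h.nonneg z) (h'.nonneg z)).1
    (hz n (mem_ball_zero_iff.2 hn))

/-! ### The zeros of the noisy pair of chirps -/

/-- The intensity in the time-frequency plane. -/
def chirpIntensity (γ₁ γ₂ a₁ a₂ b : ℝ) (z : ℂ) : ℝ :=
  rhoRS γ₁ γ₂ a₁ a₂ b (rCoord a₁ b z) (sCoord a₁ a₂ b z)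

theorem continuous_chirpIntensity (γ₁ γ₂ a₁ a₂ b : ℝ) :
    Continuous (chirpIntensity γ₁ γ₂ a₁ a₂ b) := by
  unfold chirpIntensity rhoRS specRS rCoord sCoord
  have := Complex.continuous_re
  have := Complex.continuous_im
  fun_prop

theorem chirpIntensity_nonneg {γ₁ γ₂ : ℝ} (a₁ a₂ b : ℝ) (hγ₁ : 0 ≤ γ₁) (hγ₂ : 0 ≤ γ₂) (z : ℂ) :
    0 ≤ chirpIntensity γ₁ γ₂ a₁ a₂ b z := by
  rw [chirpIntensity, ← normSq_chirpPairDeriv_sub a₁ a₂ b hγ₁ hγ₂]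
  have := Real.pi_pos
  positivity

/-- The kernel gives `s = exp (π ‖w‖²)`, regression coefficient `π conj w` and residual variance `π
s`, whence the Kac–Rice density. Taking `w ≠ 0` ensures `s > 1`, as `bargmannAtom w - bargmannAtom
0` degenerates at the origin. -/
theorem lintegral_density_eq (hξ : IsComplexWhiteNoise P ξ) {γ₁ γ₂ : ℝ} (a₁ a₂ b : ℝ)
    (hγ₁ : 0 ≤ γ₁) (hγ₂ : 0 ≤ γ₂) {w : ℂ} (hw : w ≠ 0) :
    ∫⁻ ω, ENNReal.ofReal (Real.pi⁻¹ *
      Real.exp (-‖bargmannTransform (chirpPair γ₁ γ₂ a₁ a₂ b) w +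
        ξ ω (bargmannAtom w - bargmannAtom 0)‖ ^ 2) *
      ‖chirpPairDeriv γ₁ γ₂ a₁ a₂ b w + ξ ω (bargmannAtomDeriv w)‖ ^ 2) ∂P =
    ENNReal.ofReal (chirpIntensity γ₁ γ₂ a₁ a₂ b ((starRingEnd ℂ) w)) := by
  set s : ℝ := Real.exp (Real.pi * ‖w‖ ^ 2) with hs
  have hs1 : 1 < s := Real.one_lt_exp_iff.2 (by positivity)
  have hsw : Complex.exp (Real.pi * w * (starRingEnd ℂ) w) = s := by
    rw [mul_assoc, Complex.mul_conj', hs]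
    push_cast
    rfl
  have hα : pairing (bargmannAtom w - bargmannAtom 0) (bargmannAtom w - bargmannAtom 0) = s - 1 := by
    simp [pairing_sub_left, pairing_sub_right, pairing_bargmannAtom, hsw]
  have hβα : pairing (bargmannAtomDeriv w) (bargmannAtom w - bargmannAtom 0) =
      Real.pi * (starRingEnd ℂ) w * s := by
    simp [pairing_sub_right, pairing_bargmannAtomDeriv_bargmannAtom, hsw]
  have hββ : (pairing (bargmannAtomDeriv w) (bargmannAtomDeriv w)).re =
      (Real.pi + Real.pi ^ 2 * ‖w‖ ^ 2) * s := by
    rw [pairing_bargmannAtomDeriv, hsw, mul_assoc _ w, Complex.mul_conj']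
    norm_cast
  have hs1' : (s : ℂ) - 1 ≠ 0 := by
    rw [← Complex.ofReal_one, ← Complex.ofReal_sub]
    exact_mod_cast (sub_pos.2 hs1).ne'
  have hs0 : (s : ℂ) ≠ 0 := by exact_mod_cast (by linarith : s ≠ 0)
  have hsr : s ≠ 0 := by linarith
  rw [lintegral_exp_normSq_mul_normSq hξ _ _
    (Real.pi * (starRingEnd ℂ) w * s / (s - 1)) _ _ hs1 hα
    (by rw [hβα, hα]; field_simp)]
  congr 1
  have hid := normSq_chirpPairDeriv_sub a₁ a₂ b hγ₁ hγ₂ ((starRingEnd ℂ) w)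
  have hsp := spectrogram_chirpPair a₁ a₂ b hγ₁ hγ₂ ((starRingEnd ℂ) w)
  rw [spectrogram_eq] at hsp
  simp only [Complex.conj_conj, RCLike.norm_conj] at hid hsp
  rw [chirpIntensity, ← hid, ← hsp, hβα, hββ, mul_div_assoc, div_self hs0, mul_one, norm_mul,
    norm_mul, Complex.norm_real, Complex.norm_real, RCLike.norm_conj, Real.norm_eq_abs,
    Real.norm_eq_abs, mul_pow, mul_pow, sq_abs, sq_abs, neg_div]
  have := Real.pi_ne_zero
  field_simp
  ring

theorem expected_count_chirpPair (hξ : IsComplexWhiteNoise P ξ) {γ₁ γ₂ : ℝ} (a₁ a₂ b : ℝ)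
    (hγ₁ : 0 ≤ γ₁) (hγ₂ : 0 ≤ γ₂) {A : Set ℂ} (hA : IsOpen A) :
    Measurable (fun ω => Measure.count
      (A ∩ {z | noisySpectrogram (chirpPair γ₁ γ₂ a₁ a₂ b) (ξ ω) z = 0})) ∧
    ∫⁻ ω, Measure.count
      (A ∩ {z | noisySpectrogram (chirpPair γ₁ γ₂ a₁ a₂ b) (ξ ω) z = 0}) ∂P =
      ∫⁻ z in A, ENNReal.ofReal (chirpIntensity γ₁ γ₂ a₁ a₂ b z) := by
  let m := bargmannTransform (chirpPair γ₁ γ₂ a₁ a₂ b)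
  let Y : Ω → ℂ → ℂ := fun ω w => m w + ξ ω (bargmannAtom w - bargmannAtom 0)
  have hderiv : ∀ ω w, HasDerivAt (Y ω)
      (chirpPairDeriv γ₁ γ₂ a₁ a₂ b w + ξ ω (bargmannAtomDeriv w)) w := by
    intro ω w
    simp only [Y, map_sub]
    exact (hasDerivAt_bargmannTransform_chirpPair γ₁ γ₂ a₁ a₂ b w).add
      ((hasDerivAt_apply_bargmannAtom (ξ ω) w).sub_const _)
  -- Both pairings of `bargmannAtom 0`, with `bargmannAtom w` and with itself, equal 1, so their
  -- difference is 0.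
  have hind : ProbabilityTheory.IndepFun (fun ω => ξ ω (bargmannAtom 0)) Y P := by
    have h := indepFun_apply hξ (fun _ : Unit => bargmannAtom 0)
      (fun w : ℂ => bargmannAtom w - bargmannAtom 0) fun _ w => by
        simp [pairing_sub_right, pairing_bargmannAtom]
    exact h.comp (measurable_pi_apply ()) (measurable_pi_iff.2 fun w =>
      (measurable_pi_apply w).const_add (m w))
  -- The transform is holomorphic in `conj z`; conjugation preserves both Lebesgue and counting
  -- measure.
  let C : ℂ ≃ₗᵢ[ℝ] ℂ := Complex.conjLIE
  have hCA : IsOpen (C ⁻¹' A) := hA.preimage C.continuous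
  have hcount := expected_count_add (hξ.measurable (bargmannAtom 0))
    (map_apply_of_norm_one hξ (by simp [pairing_bargmannAtom]))
    (fun ω w => (hderiv ω w).differentiableAt) (fun w => (hξ.measurable _).const_add _)
    (fun w => by
      simp only [(hderiv _ w).deriv]
      exact (hξ.measurable _).const_add _) hind hCA
  have hset : ∀ ω, Measure.count
      (A ∩ {z | noisySpectrogram (chirpPair γ₁ γ₂ a₁ a₂ b) (ξ ω) z = 0}) =
      Measure.count {w ∈ C ⁻¹' A | ξ ω (bargmannAtom 0) + Y ω w = 0} := by
    intro ω
    rw [← Measure.count_injective_image C.injective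
      {w ∈ C ⁻¹' A | ξ ω (bargmannAtom 0) + Y ω w = 0}]
    congr 1
    ext z
    simp only [Set.mem_inter_iff, Set.mem_ofPred_eq, Set.mem_image, Set.mem_preimage,
      noisySpectrogram_eq_zero_iff, Y, map_sub, m]
    constructor
    · rintro ⟨hz, h0⟩
      refine ⟨(starRingEnd ℂ) z, ⟨by simpa [C] using hz, ?_⟩, by simp [C]⟩
      rw [← h0]
      ring
    · rintro ⟨w, ⟨hw, h0⟩, rfl⟩
      refine ⟨hw, ?_⟩
      simp only [C, Complex.conjLIE_apply, Complex.conj_conj]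
      rw [← h0]
      ring
  simp only [hset]
  refine ⟨hcount.1, hcount.2.trans ?_⟩
  rw [← C.measurePreserving.setLIntegral_comp_preimage hA.measurableSet
    (continuous_chirpIntensity γ₁ γ₂ a₁ a₂ b).measurable.ennreal_ofReal]
  refine setLIntegral_congr_fun_ae hCA.measurableSet ?_
  filter_upwards [Measure.ae_ne volume (0 : ℂ)] with w hw _
  simp only [(hderiv _ w).deriv]
  exact lintegral_density_eq hξ a₁ a₂ b hγ₁ hγ₂ hw

theorem isZeroIntensity_chirpPair (hξ : IsComplexWhiteNoise P ξ) {γ₁ γ₂ : ℝ} (a₁ a₂ b : ℝ)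
    (hγ₁ : 0 ≤ γ₁) (hγ₂ : 0 ≤ γ₂) :
    IsZeroIntensity P (fun ω => noisySpectrogram (chirpPair γ₁ γ₂ a₁ a₂ b) (ξ ω))
      (chirpIntensity γ₁ γ₂ a₁ a₂ b) := by
  have hcont : ∀ ω, MeasurableSet
      {z | noisySpectrogram (chirpPair γ₁ γ₂ a₁ a₂ b) (ξ ω) z = 0} := by
    intro ω
    simp only [noisySpectrogram_eq_zero_iff]
    have h1 : Continuous (bargmannTransform (chirpPair γ₁ γ₂ a₁ a₂ b)) :=
      continuous_iff_continuousAt.2 fun w =>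
        (hasDerivAt_bargmannTransform_chirpPair γ₁ γ₂ a₁ a₂ b w).continuousAt
    have h2 : Continuous fun w => ξ ω (bargmannAtom w) :=
      continuous_iff_continuousAt.2 fun w => (hasDerivAt_apply_bargmannAtom (ξ ω) w).continuousAt
    exact (isClosed_eq ((h1.comp Complex.continuous_conj).add (h2.comp Complex.continuous_conj))
      continuous_const).measurableSet
  have hmain : ∀ A : Set ℂ, MeasurableSet A → Bornology.IsBounded A →
      AEMeasurable (fun ω => (zeroCount
        (noisySpectrogram (chirpPair γ₁ γ₂ a₁ a₂ b) (ξ ω)) A : ENNReal)) P ∧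
      ∫⁻ ω, (zeroCount (noisySpectrogram (chirpPair γ₁ γ₂ a₁ a₂ b) (ξ ω)) A : ENNReal) ∂P =
        ∫⁻ z in A, ENNReal.ofReal (chirpIntensity γ₁ γ₂ a₁ a₂ b z) := by
    intro A hA hb
    -- On a ball the continuous intensity has finite integral, as the π-λ argument requires.
    obtain ⟨R, hR⟩ := hb.subset_ball (0 : ℂ)
    have hfin : ∫⁻ z in Metric.ball (0 : ℂ) R,
        ENNReal.ofReal (chirpIntensity γ₁ γ₂ a₁ a₂ b z) ≠ ⊤ := by
      have hint : IntegrableOn (chirpIntensity γ₁ γ₂ a₁ a₂ b) (Metric.ball (0 : ℂ) R) :=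
        ((continuous_chirpIntensity γ₁ γ₂ a₁ a₂ b).continuousOn.integrableOn_compact
          (isCompact_closedBall (0 : ℂ) R)).mono_set Metric.ball_subset_closedBall
      exact hint.lintegral_lt_top.ne
    have h := expected_count_of_isOpen (P := P) hcont Metric.isOpen_ball hfin
      (fun B hB _ => expected_count_chirpPair hξ a₁ a₂ b hγ₁ hγ₂ hB) hA
    rw [Set.inter_eq_left.2 hR] at h
    have hz : ∀ ω, (zeroCount (noisySpectrogram (chirpPair γ₁ γ₂ a₁ a₂ b) (ξ ω)) A : ENNReal) =
        Measure.count (A ∩ {z | noisySpectrogram (chirpPair γ₁ γ₂ a₁ a₂ b) (ξ ω) z = 0}) := by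
      intro ω
      rw [Measure.count_apply (hA.inter (hcont ω))]
      rfl
    simp only [hz]
    exact h
  exact ⟨(continuous_chirpIntensity γ₁ γ₂ a₁ a₂ b).measurable,
    chirpIntensity_nonneg a₁ a₂ b hγ₁ hγ₂, fun A hA hb => (hmain A hA hb).1,
    fun A hA hb => (hmain A hA hb).2⟩

end NoisyChirps

end

theorem proposition6 {Ω : Type*} [MeasurableSpace Ω] (P : MeasureTheory.Measure Ω)
    [MeasureTheory.IsProbabilityMeasure P] (ξ : Ω → 𝓢'(ℝ, ℂ))
    (hξ : NoisyChirps.IsComplexWhiteNoise P ξ)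
    (γ₁ γ₂ a₁ a₂ b : ℝ) (hγ₁ : 0 < γ₁) (hγ₂ : 0 < γ₂) :
    -- the spectrogram of the noiseless signal in the coordinates `(r, s)`
    (∀ z : ℂ, NoisyChirps.spectrogram (NoisyChirps.chirpPair γ₁ γ₂ a₁ a₂ b) z =
      NoisyChirps.specRS γ₁ γ₂ a₁ a₂ b
        (NoisyChirps.rCoord a₁ b z) (NoisyChirps.sCoord a₁ a₂ b z)) ∧
    -- the zeros of the noisy spectrogram have intensity `ρ(r, s)`
    NoisyChirps.IsZeroIntensity P
      (fun ω => NoisyChirps.noisySpectrogram (NoisyChirps.chirpPair γ₁ γ₂ a₁ a₂ b) (ξ ω))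
      (fun z => NoisyChirps.rhoRS γ₁ γ₂ a₁ a₂ b
        (NoisyChirps.rCoord a₁ b z) (NoisyChirps.sCoord a₁ a₂ b z)) ∧
    -- and this is, up to Lebesgue-null sets, their only intensity function
    (∀ ρ : ℂ → ℝ,
      NoisyChirps.IsZeroIntensity P
        (fun ω => NoisyChirps.noisySpectrogram (NoisyChirps.chirpPair γ₁ γ₂ a₁ a₂ b) (ξ ω)) ρ →
      ρ =ᵐ[MeasureTheory.volume] fun z => NoisyChirps.rhoRS γ₁ γ₂ a₁ a₂ b
        (NoisyChirps.rCoord a₁ b z) (NoisyChirps.sCoord a₁ a₂ b z)) :=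
  ⟨NoisyChirps.spectrogram_chirpPair a₁ a₂ b hγ₁.le hγ₂.le,
    NoisyChirps.isZeroIntensity_chirpPair hξ a₁ a₂ b hγ₁.le hγ₂.le,
    fun _ h => h.ae_eq (NoisyChirps.isZeroIntensity_chirpPair hξ a₁ a₂ b hγ₁.le hγ₂.le)⟩
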